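/- A classical linkage in $\mathbb R^n$ consists of a finite graph $L$ (no loops or multiple edges) with vertex set $\mathcal V$ and edge set $\mathcal E$, a length function $\ell:\mathcal E\to(0,\infty)$, a subset $V\subset\mathcal V$ of fixed vertices and a map $\mu:V\to\mathbb R^n$. Its configuration space is $$\mathcal C(\mathcal L)=\{\varphi:\mathcal V\to\mathbb R^n \mid \varphi(v)=\mu(v)\text{ for }v\in V,\ |\varphi(v)-\varphi(w)|=\ell(vw)\text{ for every edge }vw\in\mathcal E\}\subset(\mathbb R^n)^{\mathcal V}.$$ A real algebraic set is the set of common zeros in some $\mathbb R^d$ of a collection of real polynomials. A homeomorphism $f:X\to Y$ between subsets of Euclidean spaces is an isomorphism if $f$ and $f^{-1}$ are both restrictions of entire rational maps (coordinates are quotients of polynomials with nowhere vanishing denominator), and an analytic isomorphism if $f$ and $f^{-1}$ are both restrictions of real analytic maps defined on neighbourhoods of $X$ and of $Y$. Let $n\ge 2$. (1) Let $\mathcal L$ be a classical linkage in $\mathbb R^n$, and let $k$ be the number of connected components of $\mathcal L$ that contain no fixed vertex. Then $\mathcal C(\mathcal L)$ is isomorphic to $X\times(\mathbb R^n)^k$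 for some compact real algebraic set $X$. (2) Conversely, let $X$ be a compact real algebraic set and $k\ge 0$ an integer. Then there are a classical linkage $\mathcal L$ in $\mathbb R^n$ and a nonempty finite set $F$ (of real numbers) such that $\mathcal C(\mathcal L)$ is analytically isomorphic to $X\times F\times(\mathbb R^n)^k$. In fact, if $X\subset(\mathbb R^n)^a$, then $\mathcal L$ (with $a+m$ vertices, for some $m$, so that $\mathcal C(\mathcal L)\subset(\mathbb R^n)^a\times(\mathbb R^n)^m$) and $F$ can be chosen such that there is an analytic function $\alpha:X\times F\times(\mathbb R^n)^k\to(\mathbb R^n)^m$ with $$\mathcal C(\mathcal L)=\{(x,\alpha(x,f,y))\mid x\in X,\ f\in F,\ y\in(\mathbb R^n)^k\}$$ and such that the map $(x,f,y)\mapsto(x,\alpha(x,f,y))$ is an analytic isomorphism from $X\times F\times(\mathbb R^n)^k$ onto $\mathcal C(\mathcal L)$. -/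

import Mathlib

open Set

/-- `ℝⁿ` with its Euclidean distance. -/
abbrev Rn (n : ℕ) : Type := EuclideanSpace ℝ (Fin n)

section Maps

variable {E E' : Type*} [NormedAddCommGroup E] [NormedSpace ℝ E]
  [NormedAddCommGroup E'] [NormedSpace ℝ E']

/-- Polynomial functions on a (finite dimensional) real vector space: the algebra of functions
generated by the linear functionals. On `ℝᵐ` these are the polynomials in the coordinates. -/
def IsPolynomialFunction (p : E → ℝ) : Prop :=
  p ∈ Algebra.adjoin ℝ (Set.range fun (φ : Module.Dual ℝ E) (x : E) => φ x)

/-- A real algebraic set: the set of common zeros of a collection of polynomials. -/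
def IsRealAlgebraicSet (X : Set E) : Prop :=
  ∃ S : Set (E → ℝ), (∀ p ∈ S, IsPolynomialFunction p) ∧ X = {x | ∀ p ∈ S, p x = 0}

/-- An entire rational function: a quotient of polynomials with nowhere zero denominator. -/
def IsEntireRationalFunction (r : E → ℝ) : Prop :=
  ∃ p q : E → ℝ, IsPolynomialFunction p ∧ IsPolynomialFunction q ∧
    ∀ x, q x ≠ 0 ∧ r x = p x / q x

/-- A map all of whose (linear) coordinates are entire rational functions. -/
def IsEntireRationalMap (f : E → E') : Prop :=
  ∀ φ : Module.Dual ℝ E', IsEntireRationalFunction fun x => φ (f x)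

/-- `X ⊆ E` and `Y ⊆ E'` are isomorphic: there are mutually inverse bijections between them which
are restrictions of entire rational maps. (Such maps are continuous, so these bijections are
homeomorphisms.) -/
def AreIsomorphic (X : Set E) (Y : Set E') : Prop :=
  ∃ (f : E → E') (g : E' → E), IsEntireRationalMap f ∧ IsEntireRationalMap g ∧
    MapsTo f X Y ∧ MapsTo g Y X ∧ InvOn g f X Y

/-- On `X`, the map `f` is the restriction of an analytic map defined on a neighbourhood of `X`.
Only the values of `f` on `X` matter. -/
def IsAnalyticOnSet (f : E → E') (X : Set E) : Prop :=
  ∃ F : E → E', AnalyticOnNhd ℝ F X ∧ EqOn f F X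

/-- `f` restricts to an analytic isomorphism from `X` onto `Y`: a bijection such that both it and
its inverse are restrictions of analytic maps. -/
def IsAnalyticIso (f : E → E') (X : Set E) (Y : Set E') : Prop :=
  IsAnalyticOnSet f X ∧ MapsTo f X Y ∧
    ∃ g : E' → E, IsAnalyticOnSet g Y ∧ MapsTo g Y X ∧ InvOn g f X Y

/-- `X` and `Y` are analytically isomorphic. -/
def AreAnalyticallyIsomorphic (X : Set E) (Y : Set E') : Prop :=
  ∃ f : E → E', IsAnalyticIso f X Y

end Maps

/-- A classical linkage in `ℝⁿ` with vertex set `V` (which is finite wherever linkages are used):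
a graph with positive edge lengths, together with a set of fixed vertices and their positions. -/
structure ClassicalLinkage (n : ℕ) (V : Type*) where
  graph : SimpleGraph V
  len : graph.edgeSet → Ioi (0 : ℝ)
  fixed : Set V
  pos : fixed → Rn n

namespace ClassicalLinkage

variable {n : ℕ} {V : Type*}

/-- The configuration space, a subset of `(ℝⁿ)^V`. -/
def configSpace (L : ClassicalLinkage n V) : Set (V → Rn n) :=
  {φ | (∀ v : L.fixed, φ v = L.pos v) ∧
    ∀ (v w : V) (h : L.graph.Adj v w), dist (φ v) (φ w) = (L.len ⟨s(v, w), h⟩ : ℝ)}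

/-- The number of connected components which contain no fixed vertex. -/
noncomputable def numFreeComponents (L : ClassicalLinkage n V) : ℕ :=
  Nat.card {c : L.graph.ConnectedComponent // Disjoint c.supp L.fixed}

end ClassicalLinkage

/-! Linkage to algebraic set: configurations are the solutions of polynomial equations, and
translating a component without fixed vertices preserves them. Pinning one vertex of each such
component at the origin leaves a closed set, bounded because every vertex is joined by finitely many
bars to a point of known position. The translations supply the factors of `ℝⁿ`, and splitting them
off is linear (`ClassicalLinkage.exists_areIsomorphic`).

Algebraic set to linkage: everything is done locally, near one base configuration, and compactness
enters only through a rescaling. A `LinkGerm` is a relation that some linkage enforces near the base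
configuration, with auxiliary vertices given by finitely many analytic branches. Germs can be
intersected, pulled back and composed. Composition requires that no unwanted configuration lies
elsewhere, so vertices are tethered near their base positions by two-bar arms (`LinkGerm.localize`).
The two elbow positions of each tether are the only source of several branches, hence of the finite
factor `F`; their square roots make the isomorphism analytic rather than rational.

Functions computed by linkages (`ConstructibleAt`) are then built up: braced parallelograms give
vector addition and scaling, an inversor gives straight lines, lines give coordinates, and
Pythagoras gives square roots, then reciprocals, squares and products. Hence every polynomial is
computable near any base configuration.

To pass from local to global, homogenize the equation `p = 0` of `X` with an extra scalar `ε` and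
work near the base configuration `0`. For small fixed `ε` the compact set `ε • X` lies where the
germ is valid; fixing `ε` by a pinned vertex and magnifying by `ε⁻¹` gives a linkage for `X` itself
(`exists_config_cover`). Unconstrained vertices supply `(ℝⁿ)ᵏ` (`exists_config_iso`). -/

open Set Filter Topology

/-! ### Sets cut out by distance and position conditions, and their realization by linkages. -/

section Config

variable {n : ℕ} {ι κ : Type*}

/-- Sets of configurations cut out by finitely or infinitely many distance conditions with positive
distances, and by prescribing the position of some of the points. -/
def IsConfig (S : Set (ι → Rn n)) : Prop :=
  ∃ (edges : Set (ι × ι × ℝ)) (pins : Set (ι × Rn n)), (∀ e ∈ edges, 0 < e.2.2) ∧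
    S = {φ | (∀ e ∈ edges, dist (φ e.1) (φ e.2.1) = e.2.2) ∧ ∀ p ∈ pins, φ p.1 = p.2}

theorem isConfig_dist (i j : ι) {l : ℝ} (hl : 0 < l) :
    IsConfig {φ : ι → Rn n | dist (φ i) (φ j) = l} :=
  ⟨{(i, j, l)}, ∅, by simpa using hl, by simp⟩

theorem isConfig_pin (i : ι) (c : Rn n) : IsConfig {φ : ι → Rn n | φ i = c} :=
  ⟨∅, {(i, c)}, by simp, by simp⟩

theorem isConfig_iInter {A : Type*} {S : A → Set (ι → Rn n)} (h : ∀ a, IsConfig (S a)) :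
    IsConfig (⋂ a, S a) := by
  choose e p he hS using h
  refine ⟨⋃ a, e a, ⋃ a, p a, ?_, ?_⟩
  · intro x hx
    obtain ⟨a, ha⟩ := mem_iUnion.1 hx
    exact he a x ha
  · ext φ
    simp only [hS, mem_iInter, mem_ofPred_eq, mem_iUnion]
    constructor
    · intro h
      exact ⟨fun x ⟨a, ha⟩ => (h a).1 x ha, fun x ⟨a, ha⟩ => (h a).2 x ha⟩
    · intro h a
      exact ⟨fun x ha => h.1 x ⟨a, ha⟩, fun x ha => h.2 x ⟨a, ha⟩⟩

theorem isConfig_univ : IsConfig (univ : Set (ι → Rn n)) := ⟨∅, ∅, by simp, by simp⟩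

theorem IsConfig.inter {S T : Set (ι → Rn n)} (hS : IsConfig S) (hT : IsConfig T) :
    IsConfig (S ∩ T) := by
  rw [inter_eq_iInter]
  exact isConfig_iInter fun b => by cases b <;> assumption

theorem isConfig_forall {A : Type*} {S : A → (ι → Rn n) → Prop}
    (h : ∀ a, IsConfig {φ | S a φ}) : IsConfig {φ | ∀ a, S a φ} := by
  have := isConfig_iInter h
  rwa [← ofPred_forall] at this

theorem IsConfig.comap {S : Set (ι → Rn n)} (hS : IsConfig S) (σ : ι → κ) :
    IsConfig {φ : κ → Rn n | φ ∘ σ ∈ S} := by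
  obtain ⟨e, p, he, rfl⟩ := hS
  refine ⟨(fun x => (σ x.1, σ x.2.1, x.2.2)) '' e, (fun x => (σ x.1, x.2)) '' p, ?_, ?_⟩
  · rintro _ ⟨x, hx, rfl⟩
    exact he x hx
  · ext φ
    simp only [mem_ofPred_eq, forall_mem_image, Function.comp_apply]

/-- Dividing all lengths and pins by `ε` magnifies a linkage; this later turns a construction valid
only near the origin into one for a whole compact set. -/
theorem IsConfig.smul {S : Set (ι → Rn n)} (hS : IsConfig S) {ε : ℝ} (hε : 0 < ε) :
    IsConfig {φ : ι → Rn n | ε • φ ∈ S} := by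
  obtain ⟨e, p, he, rfl⟩ := hS
  refine ⟨(fun x => (x.1, x.2.1, ε⁻¹ * x.2.2)) '' e, (fun x => (x.1, ε⁻¹ • x.2)) '' p, ?_, ?_⟩
  · rintro _ ⟨x, hx, rfl⟩
    have := he x hx
    positivity
  · ext φ
    simp only [mem_ofPred_eq, forall_mem_image, Pi.smul_apply, dist_smul₀, Real.norm_eq_abs,
      abs_of_pos hε]
    refine and_congr (forall₂_congr fun x _ => ?_) (forall₂_congr fun x _ => ?_)
    · rw [eq_inv_mul_iff_mul_eq₀ hε.ne']
    · rw [eq_inv_smul_iff₀ hε.ne']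

/-- A bar of length one from a vertex to itself is allowed here, unlike in a linkage. -/
theorem isConfig_empty [Nonempty ι] : IsConfig (∅ : Set (ι → Rn n)) := by
  obtain ⟨i⟩ := ‹Nonempty ι›
  convert isConfig_dist (n := n) i i one_pos
  simp

/-- Every such set of configurations is the configuration space of a classical linkage. -/
theorem IsConfig.exists_linkage {S : Set (ι → Rn n)} (hS : IsConfig S)
    (h : S.Nonempty ∨ Nontrivial ι) : ∃ L : ClassicalLinkage n ι, L.configSpace = S := by
  rcases S.eq_empty_or_nonempty with rfl | ⟨φ₀, h₀⟩
  · have := h.resolve_left not_nonempty_empty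
    obtain ⟨i, j, hij⟩ := exists_pair_ne ι
    -- Two vertices fixed at the same point but joined by a bar of length one; this is why an empty
    -- set needs two vertices.
    refine ⟨⟨⊤, fun _ => ⟨1, mem_Ioi.2 one_pos⟩, univ, fun _ => 0⟩, ?_⟩
    refine eq_empty_of_forall_notMem fun φ hφ => ?_
    have h1 := hφ.2 i j hij
    rw [hφ.1 ⟨i, trivial⟩, hφ.1 ⟨j, trivial⟩] at h1
    simp at h1
  · obtain ⟨e, p, he, rfl⟩ := hS
    -- One actual configuration `φ₀` shows that there are no loops and that repeated conditions on a
    -- pair agree. Lengths and fixed positions can therefore be read off from `φ₀`.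
    let G : SimpleGraph ι :=
      { Adj := fun i j => (∃ l, (i, j, l) ∈ e) ∨ ∃ l, (j, i, l) ∈ e
        symm := ⟨fun i j h => h.symm⟩
        loopless := ⟨by
          intro i h
          rcases h with ⟨l, hl⟩ | ⟨l, hl⟩ <;>
          · have h1 := h₀.1 _ hl
            have h2 := he _ hl
            simp only [dist_self] at h1 h2
            exact h2.ne h1⟩ }
    have hG : ∀ i j, G.Adj i j → 0 < dist (φ₀ i) (φ₀ j) := by
      rintro i j (⟨l, hl⟩ | ⟨l, hl⟩)
      · have h1 := h₀.1 _ hl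
        exact h1 ▸ he _ hl
      · have h1 := h₀.1 _ hl
        rw [dist_comm]
        exact h1 ▸ he _ hl
    let D : Sym2 ι → ℝ := Sym2.lift ⟨fun i j => dist (φ₀ i) (φ₀ j), fun i j => dist_comm _ _⟩
    have hD : ∀ s ∈ G.edgeSet, 0 < D s := by
      intro s
      induction s using Sym2.ind with
      | _ i j => exact fun h => hG i j h
    refine ⟨⟨G, fun s => ⟨D s, hD s s.2⟩, {i | ∃ c, (i, c) ∈ p}, fun i => φ₀ i⟩, ?_⟩
    ext φ
    constructor
    · rintro ⟨h1, h2⟩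
      refine ⟨fun x hx => ?_, fun x hx => ?_⟩
      · rw [← h₀.1 x hx]
        exact h2 x.1 x.2.1 (Or.inl ⟨x.2.2, hx⟩)
      · rw [← h₀.2 x hx]
        exact h1 ⟨x.1, x.2, hx⟩
    · rintro ⟨h1, h2⟩
      refine ⟨?_, ?_⟩
      · rintro ⟨i, c, hc⟩
        exact (h2 _ hc).trans (h₀.2 _ hc).symm
      · rintro i j (⟨l, hl⟩ | ⟨l, hl⟩)
        · exact (h1 _ hl).trans (h₀.1 _ hl).symm
        · show dist (φ i) (φ j) = dist (φ₀ i) (φ₀ j)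
          rw [dist_comm, dist_comm (φ₀ i)]
          exact (h1 _ hl).trans (h₀.1 _ hl).symm

end Config

/-! ### Relations enforced by linkages near a configuration, and operations on them. -/

section Germ

variable {n : ℕ} {ι κ : Type} [Fintype ι] [Fintype κ]

/-- Near `x₀`, the set `R` is the image of a configuration space with finitely many additional
points, the position of which is given by finitely many analytic functions with distinct values.
All configurations lie over `U`. -/
def LinkGermIn (R U : Set (ι → Rn n)) (x₀ : ι → Rn n) : Prop :=
  ∃ (κ : Type) (_ : Fintype κ) (N : Type) (_ : Fintype N) (_ : Nonempty N)
    (S : Set (ι ⊕ κ → Rn n)) (α : N → (ι → Rn n) → κ → Rn n),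
    IsConfig S ∧ (∀ φ ∈ S, φ ∘ Sum.inl ∈ U) ∧ (∀ f, AnalyticAt ℝ (α f) x₀) ∧
    Function.Injective (fun f => α f x₀) ∧
    ∀ᶠ x in 𝓝 x₀, ∀ y, Sum.elim x y ∈ S ↔ x ∈ R ∧ ∃ f, y = α f x

/-- As `LinkGermIn`, without a condition on the configurations away from `x₀`. -/
def LinkGerm (R : Set (ι → Rn n)) (x₀ : ι → Rn n) : Prop := LinkGermIn R univ x₀

theorem LinkGermIn.mono {R U V : Set (ι → Rn n)} {x₀ : ι → Rn n} (h : LinkGermIn R U x₀) (hUV : U ⊆ V) :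
    LinkGermIn R V x₀ := by
  obtain ⟨κ, _, N, _, _, S, α, h1, h2, h⟩ := h
  exact ⟨κ, inferInstance, N, inferInstance, ‹_›, S, α, h1, fun φ hφ => hUV (h2 φ hφ), h⟩

theorem LinkGermIn.linkGerm {R U : Set (ι → Rn n)} {x₀ : ι → Rn n} (h : LinkGermIn R U x₀) : LinkGerm R x₀ :=
  h.mono (subset_univ _)

theorem LinkGermIn.congr {R R' U : Set (ι → Rn n)} {x₀ : ι → Rn n} (h : LinkGermIn R U x₀)
    (hR : ∀ᶠ x in 𝓝 x₀, x ∈ R ↔ x ∈ R') : LinkGermIn R' U x₀ := by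
  obtain ⟨κ, _, N, _, _, S, α, h1, h2, h3, h4, h5⟩ := h
  refine ⟨κ, inferInstance, N, inferInstance, ‹_›, S, α, h1, h2, h3, h4, ?_⟩
  filter_upwards [h5, hR] with x hx hx'
  rw [← hx']
  exact hx

theorem LinkGerm.congr {R R' : Set (ι → Rn n)} {x₀ : ι → Rn n} (h : LinkGerm R x₀)
    (hR : ∀ᶠ x in 𝓝 x₀, x ∈ R ↔ x ∈ R') : LinkGerm R' x₀ := LinkGermIn.congr h hR

theorem IsConfig.linkGerm {S : Set (ι → Rn n)} (hS : IsConfig S) (x₀ : ι → Rn n) : LinkGerm S x₀ := by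
  refine ⟨Empty, inferInstance, Unit, inferInstance, inferInstance, {φ | φ ∘ Sum.inl ∈ S},
    fun _ _ => Empty.elim, hS.comap _, fun _ _ => trivial, fun _ => analyticAt_const,
    fun _ _ _ => rfl, Eventually.of_forall fun x y => ?_⟩
  simp only [mem_ofPred_eq, Sum.elim_comp_inl]
  exact ⟨fun h => ⟨h, (), Subsingleton.elim _ _⟩, fun h => h.1⟩

theorem analyticAt_comp_index {ι κ : Type*} [Fintype ι] [Fintype κ] (σ : ι → κ) (x : κ → Rn n) :
    AnalyticAt ℝ (fun z : κ → Rn n => z ∘ σ) x :=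
  AnalyticAt.pi fun i => (ContinuousLinearMap.proj (R := ℝ) (φ := fun _ : κ => Rn n) (σ i)).analyticAt x

theorem AnalyticAt.sumElim {F : Type*} [NormedAddCommGroup F] [NormedSpace ℝ F]
    {ι κ : Type*} [Fintype ι] [Fintype κ]
    {f : F → ι → Rn n} {g : F → κ → Rn n} {x : F}
    (hf : AnalyticAt ℝ f x) (hg : AnalyticAt ℝ g x) :
    AnalyticAt ℝ (fun y => (Sum.elim (f y) (g y) : ι ⊕ κ → Rn n)) x :=
  AnalyticAt.pi fun
    | .inl i => analyticAt_pi_iff.1 hf i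
    | .inr i => analyticAt_pi_iff.1 hg i

/-- The two linkages are glued along the common vertices `ι` with their auxiliary vertices kept
apart, so branches are chosen independently. -/
theorem LinkGermIn.inter {R U R' U' : Set (ι → Rn n)} {x₀ : ι → Rn n} (h : LinkGermIn R U x₀)
    (h' : LinkGermIn R' U' x₀) : LinkGermIn (R ∩ R') (U ∩ U') x₀ := by
  obtain ⟨κ, _, N, _, _, S, α, h1, h2, h3, h4, h5⟩ := h
  obtain ⟨κ', _, N', _, _, S', α', h1', h2', h3', h4', h5'⟩ := h'
  refine ⟨κ ⊕ κ', inferInstance, N × N', inferInstance, inferInstance,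
    {φ | φ ∘ Sum.map id Sum.inl ∈ S} ∩ {φ | φ ∘ Sum.map id Sum.inr ∈ S'},
    fun f x => Sum.elim (α f.1 x) (α' f.2 x), (h1.comap _).inter (h1'.comap _),
    fun φ hφ => ⟨h2 _ hφ.1, h2' _ hφ.2⟩, fun f => (h3 _).sumElim (h3' _), ?_, ?_⟩
  · rintro ⟨f, f'⟩ ⟨g, g'⟩ hfg
    rw [Sum.elim_eq_iff] at hfg
    exact Prod.ext (h4 hfg.1) (h4' hfg.2)
  · filter_upwards [h5, h5'] with x hx hx' y
    have e1 : (Sum.elim x y ∘ Sum.map id Sum.inl : ι ⊕ κ → Rn n) = Sum.elim x (y ∘ Sum.inl) := by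
      ext (i | i) <;> rfl
    have e2 : (Sum.elim x y ∘ Sum.map id Sum.inr : ι ⊕ κ' → Rn n) = Sum.elim x (y ∘ Sum.inr) := by
      ext (i | i) <;> rfl
    rw [mem_inter_iff, mem_ofPred_eq, mem_ofPred_eq, e1, e2, hx, hx']
    constructor
    · rintro ⟨⟨a, f, hf⟩, b, f', hf'⟩
      exact ⟨⟨a, b⟩, (f, f'), by rw [← hf, ← hf', Sum.elim_comp_inl_inr]⟩
    · rintro ⟨⟨a, b⟩, ⟨f, f'⟩, rfl⟩
      exact ⟨⟨a, f, rfl⟩, b, f', rfl⟩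

theorem LinkGerm.inter {R R' : Set (ι → Rn n)} {x₀ : ι → Rn n} (h : LinkGerm R x₀) (h' : LinkGerm R' x₀) :
    LinkGerm (R ∩ R') x₀ := (LinkGermIn.inter h h').linkGerm

theorem linkGermIn_univ (x₀ : ι → Rn n) : LinkGermIn univ univ x₀ := isConfig_univ.linkGerm x₀

theorem linkGermIn_forall {A : Type*} [Finite A] {R U : A → (ι → Rn n) → Prop} {x₀ : ι → Rn n}
    (h : ∀ a, LinkGermIn {x | R a x} {x | U a x} x₀) :
    LinkGermIn {x | ∀ a, R a x} {x | ∀ a, U a x} x₀ := by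
  classical
  have := Fintype.ofFinite A
  suffices H : ∀ s : Finset A, LinkGermIn {x | ∀ a ∈ s, R a x} {x | ∀ a ∈ s, U a x} x₀ by
    simpa using H Finset.univ
  intro s
  induction s using Finset.induction_on with
  | empty => simpa using linkGermIn_univ x₀
  | insert a s _ ih =>
    simp only [Finset.forall_mem_insert]
    exact (h a).inter ih

theorem linkGerm_forall {A : Type*} [Finite A] {R : A → (ι → Rn n) → Prop} {x₀ : ι → Rn n}
    (h : ∀ a, LinkGerm {x | R a x} x₀) : LinkGerm {x | ∀ a, R a x} x₀ :=
  (linkGermIn_forall (U := fun _ _ => True) h).linkGerm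

/-- `σ` need not be injective: vertices may be identified as well as added. -/
theorem LinkGermIn.comap {R U : Set (ι → Rn n)} (σ : ι → κ) {x₀ : κ → Rn n} {z₀ : ι → Rn n}
    (h : LinkGermIn R U z₀) (hz : x₀ ∘ σ = z₀) :
    LinkGermIn {x | x ∘ σ ∈ R} {x | x ∘ σ ∈ U} x₀ := by
  subst hz
  obtain ⟨κ', _, N, _, _, S, α, h1, h2, h3, h4, h5⟩ := h
  refine ⟨κ', inferInstance, N, inferInstance, ‹_›, {φ | φ ∘ Sum.map σ id ∈ S}, fun f x => α f (x ∘ σ), h1.comap _,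
    fun φ hφ => h2 _ hφ, fun f => ?_, h4, ?_⟩
  · exact (h3 f).comp_of_eq (analyticAt_comp_index σ x₀) rfl
  · have hc := (analyticAt_comp_index σ x₀).continuousAt
    filter_upwards [hc.eventually h5] with x hx y
    have e1 : (Sum.elim x y ∘ Sum.map σ id : ι ⊕ κ' → Rn n) = Sum.elim (x ∘ σ) y := by
      ext (i | i) <;> rfl
    rw [e1, hx]

theorem LinkGerm.comap {R : Set (ι → Rn n)} (σ : ι → κ) {x₀ : κ → Rn n} {z₀ : ι → Rn n}
    (h : LinkGerm R z₀) (hz : x₀ ∘ σ = z₀) : LinkGerm {x | x ∘ σ ∈ R} x₀ := (LinkGermIn.comap σ h hz).linkGerm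

/-- Points which are analytic functions of the others can be made auxiliary. -/
theorem LinkGermIn.elim {R U : Set (ι ⊕ κ → Rn n)} {x₀ : ι → Rn n} {β : (ι → Rn n) → κ → Rn n}
    (h : LinkGermIn R U (Sum.elim x₀ (β x₀))) (hβ : AnalyticAt ℝ β x₀)
    (hU : ∀ᶠ x in 𝓝 x₀, ∀ y, Sum.elim x y ∈ U → y = β x) :
    LinkGerm {x | Sum.elim x (β x) ∈ R} x₀ := by
  obtain ⟨κ', _, N, _, _, S, α, h1, h2, h3, h4, h5⟩ := h
  have hg : AnalyticAt ℝ (fun x => (Sum.elim x (β x) : ι ⊕ κ → Rn n)) x₀ :=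
    analyticAt_id.sumElim hβ
  let τ : (ι ⊕ κ) ⊕ κ' → ι ⊕ (κ ⊕ κ') :=
    Sum.elim (Sum.elim Sum.inl (Sum.inr ∘ Sum.inl)) (Sum.inr ∘ Sum.inr)
  refine ⟨κ ⊕ κ', inferInstance, N, inferInstance, ‹_›, {φ | φ ∘ τ ∈ S},
    fun f x => Sum.elim (β x) (α f (Sum.elim x (β x))), h1.comap _, fun _ _ => trivial,
    fun f => hβ.sumElim ((h3 f).comp_of_eq hg rfl), ?_, ?_⟩
  · intro f f' hff
    rw [Sum.elim_eq_iff] at hff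
    exact h4 hff.2
  · filter_upwards [hU, hg.continuousAt.eventually h5] with x hx hx' y
    have e1 : Sum.elim x y ∘ τ = Sum.elim (Sum.elim x (y ∘ Sum.inl)) (y ∘ Sum.inr) := by
      ext ((i | i) | i) <;> rfl
    rw [e1]
    constructor
    · intro hS
      have e2 := hx _ (h2 _ hS)
      rw [e2, hx'] at hS
      obtain ⟨h, f, hf⟩ := hS
      refine ⟨h, f, ?_⟩
      rw [← hf, ← e2, Sum.elim_comp_inl_inr]
    · rintro ⟨h, f, rfl⟩
      exact (hx' _).2 ⟨h, f, rfl⟩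

end Germ

/-! ### Two-bar arms with the first bar confined to a plane. -/

section Arm

variable {n : ℕ}

theorem AnalyticAt.sqrt_of_pos {F : Type*} [NormedAddCommGroup F] [NormedSpace ℝ F] {f : F → ℝ}
    {x : F} (hf : AnalyticAt ℝ f x) (h : 0 < f x) : AnalyticAt ℝ (fun y => √(f y)) x := by
  have : AnalyticAt ℝ Real.sqrt (f x) := (Real.contDiffAt_sqrt (n := ⊤) h.ne').analyticAt
  exact this.comp hf

/-- The joint of an arm from the origin to `x` with two bars of lengths `L` and `l`, the first of
which lies in the plane spanned by `b i` and `b j`. There are two solutions, for `σ = ±1`. -/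
noncomputable def arm (b : OrthonormalBasis (Fin n) ℝ (Rn n)) (i j : Fin n) (L l σ : ℝ) (x : Rn n) :
    Rn n :=
  let X := inner ℝ (b i) x
  let Y := inner ℝ (b j) x
  let s := (‖x‖ ^ 2 + L ^ 2 - l ^ 2) / (2 * (X ^ 2 + Y ^ 2))
  let t := √(L ^ 2 / (X ^ 2 + Y ^ 2) - s ^ 2)
  (s * X - σ * t * Y) • b i + (s * Y + σ * t * X) • b j

/-- The set of points at which the two solutions exist and are distinct. -/
def IsArmRegular (b : OrthonormalBasis (Fin n) ℝ (Rn n)) (i j : Fin n) (L l : ℝ) (x : Rn n) :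
    Prop :=
  0 < inner ℝ (b i) x ^ 2 + inner ℝ (b j) x ^ 2 ∧
  0 < L ^ 2 / (inner ℝ (b i) x ^ 2 + inner ℝ (b j) x ^ 2) -
    ((‖x‖ ^ 2 + L ^ 2 - l ^ 2) / (2 * (inner ℝ (b i) x ^ 2 + inner ℝ (b j) x ^ 2))) ^ 2

variable (b : OrthonormalBasis (Fin n) ℝ (Rn n)) {i j : Fin n}

theorem planar_eq (hij : i ≠ j) {u : Rn n} (hu : ∀ k, k ≠ i → k ≠ j → inner ℝ (b k) u = (0 : ℝ)) :
    u = (inner ℝ (b i) u : ℝ) • b i + (inner ℝ (b j) u : ℝ) • b j := by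
  conv_lhs => rw [← b.sum_repr' u]
  rw [Finset.sum_eq_add i j hij] <;> simp +contextual [hu]

theorem inner_planar (a c : ℝ) (x : Rn n) :
    inner ℝ (a • b i + c • b j) x = a * inner ℝ (b i) x + c * inner ℝ (b j) x := by
  rw [inner_add_left, inner_smul_left, inner_smul_left]
  rfl

theorem norm_sq_planar (hij : i ≠ j) (a c : ℝ) : ‖a • b i + c • b j‖ ^ 2 = a ^ 2 + c ^ 2 := by
  rw [← real_inner_self_eq_norm_sq, inner_planar b, inner_add_right, inner_add_right]
  simp only [inner_smul_right, b.inner_eq_ite, if_true, hij, hij.symm, if_false]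
  ring

theorem inner_planar_of_ne (a c : ℝ) {k : Fin n} (hi : k ≠ i) (hj : k ≠ j) :
    inner ℝ (b k) (a • b i + c • b j) = (0 : ℝ) := by
  simp only [inner_add_right, inner_smul_right, b.inner_eq_ite, hi, hj, if_false]
  ring

/-- In the plane, expand `u` along `(X, Y)` and `(-Y, X)`. The two lengths fix the first coefficient
as `s`, and the norm of `u` then fixes the second up to sign as `±t`. -/
theorem arm_iff (hij : i ≠ j) {L l : ℝ} (hL : 0 ≤ L) (hl : 0 ≤ l) {x : Rn n} (hx : IsArmRegular b i j L l x)
    (u : Rn n) :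
    (‖u‖ = L ∧ ‖x - u‖ = l ∧ ∀ k, k ≠ i → k ≠ j → inner ℝ (b k) u = (0 : ℝ)) ↔
      u = arm b i j L l 1 x ∨ u = arm b i j L l (-1) x := by
  obtain ⟨hρ, ht⟩ := hx
  simp only [arm]
  set X : ℝ := inner ℝ (b i) x
  set Y : ℝ := inner ℝ (b j) x
  set ρ := X ^ 2 + Y ^ 2 with hρdef
  set s := (‖x‖ ^ 2 + L ^ 2 - l ^ 2) / (2 * ρ) with hs
  have hs' : 2 * s * ρ = ‖x‖ ^ 2 + L ^ 2 - l ^ 2 := by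
    rw [hs]; field_simp
  set t := √(L ^ 2 / ρ - s ^ 2) with htdef
  have ht2 : t ^ 2 = L ^ 2 / ρ - s ^ 2 := Real.sq_sqrt ht.le
  have ht3 : (t ^ 2 + s ^ 2) * ρ = L ^ 2 := by
    rw [ht2]; field_simp; ring
  constructor
  · rintro ⟨h1, h2, h3⟩
    have hu := planar_eq b hij h3
    set a : ℝ := inner ℝ (b i) u
    set c : ℝ := inner ℝ (b j) u
    have e1 : a ^ 2 + c ^ 2 = L ^ 2 := by rw [← norm_sq_planar b hij, ← hu, h1]
    have e2 : a * X + c * Y = s * ρ := by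
      have := norm_sub_sq_real x u
      rw [h1, h2, real_inner_comm, hu, inner_planar b] at this
      linarith
    -- Lagrange's identity expresses the squared determinant through the norms and the inner
    -- product.
    have hd : ((c * X - a * Y) / ρ) ^ 2 = t ^ 2 := by
      rw [div_pow, div_eq_iff (by positivity)]
      have : (c * X - a * Y) ^ 2 = (a ^ 2 + c ^ 2) * ρ - (a * X + c * Y) ^ 2 := by
        rw [hρdef]; ring
      rw [this, e1, e2, ← ht3]; ring
    have ea : a = s * X - (c * X - a * Y) / ρ * Y := by
      have : a * ρ = s * ρ * X - (c * X - a * Y) * Y := by rw [← e2, hρdef]; ring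
      field_simp
      linarith
    have ec : c = s * Y + (c * X - a * Y) / ρ * X := by
      have : c * ρ = s * ρ * Y + (c * X - a * Y) * X := by rw [← e2, hρdef]; ring
      field_simp
      linarith
    rcases sq_eq_sq_iff_eq_or_eq_neg.1 hd with hd | hd <;> rw [hd] at ea ec
    · left; rw [hu, one_mul, ← ea, ← ec]
    · right; rw [hu, neg_one_mul, ← ea, ← ec]
  · have key : ∀ σ : ℝ, σ ^ 2 = 1 → ∀ u, u = (s * X - σ * t * Y) • b i + (s * Y + σ * t * X) • b j →
        (‖u‖ = L ∧ ‖x - u‖ = l ∧ ∀ k, k ≠ i → k ≠ j → inner ℝ (b k) u = (0 : ℝ)) := by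
      intro σ hσ u hu
      have n1 : ‖u‖ ^ 2 = L ^ 2 := by
        rw [hu, norm_sq_planar b hij, ← ht3, hρdef]
        linear_combination t ^ 2 * (X ^ 2 + Y ^ 2) * hσ
      have n2 : ‖x - u‖ ^ 2 = l ^ 2 := by
        rw [norm_sub_sq_real, n1, real_inner_comm, hu, inner_planar b]
        rw [hρdef] at hs'
        linear_combination -hs'
      refine ⟨(sq_eq_sq₀ (norm_nonneg _) hL).1 n1, (sq_eq_sq₀ (norm_nonneg _) hl).1 n2, ?_⟩
      intro k hi hj
      rw [hu, inner_planar_of_ne b _ _ hi hj]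
    rintro (h | h)
    · exact key 1 (by norm_num) u h
    · exact key (-1) (by norm_num) u h

theorem arm_ne (hij : i ≠ j) {L l : ℝ} {x : Rn n} (hx : IsArmRegular b i j L l x) :
    arm b i j L l 1 x ≠ arm b i j L l (-1) x := by
  obtain ⟨hρ, ht⟩ := hx
  intro h
  have ht' := Real.sqrt_pos.2 ht
  simp only [arm] at h
  set X : ℝ := inner ℝ (b i) x
  set Y : ℝ := inner ℝ (b j) x
  set s := (‖x‖ ^ 2 + L ^ 2 - l ^ 2) / (2 * (X ^ 2 + Y ^ 2))
  set t := √(L ^ 2 / (X ^ 2 + Y ^ 2) - s ^ 2)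
  have h2 : ‖(-2 * t * Y) • b i + (2 * t * X) • b j‖ ^ 2 = 0 := by
    rw [sq_eq_zero_iff, norm_eq_zero, ← sub_eq_zero.2 h]
    module
  rw [norm_sq_planar b hij] at h2
  have : (2 * t) ^ 2 * (X ^ 2 + Y ^ 2) = 0 := by linarith
  have : 0 < (2 * t) ^ 2 * (X ^ 2 + Y ^ 2) := by positivity
  linarith

theorem analyticAt_inner_left (v x : Rn n) : AnalyticAt ℝ (fun y : Rn n => (inner ℝ v y : ℝ)) x :=
  (innerSL ℝ v).analyticAt x

theorem analyticAt_norm_sq (x : Rn n) : AnalyticAt ℝ (fun y : Rn n => ‖y‖ ^ 2) x :=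
  (contDiff_norm_sq ℝ (n := ⊤)).contDiffAt.analyticAt

theorem eventually_isArmRegular {L l : ℝ} {x : Rn n} (hx : IsArmRegular b i j L l x) :
    ∀ᶠ y in 𝓝 x, IsArmRegular b i j L l y := by
  have h1 : ContinuousAt (fun y : Rn n => inner ℝ (b i) y ^ 2 + inner ℝ (b j) y ^ 2) x :=
    (((analyticAt_inner_left _ _).pow 2).add ((analyticAt_inner_left _ _).pow 2)).continuousAt
  have h2 := (analyticAt_norm_sq x).continuousAt
  refine (h1.eventually_const_lt hx.1).and (Filter.Tendsto.eventually_const_lt hx.2 ?_)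
  have h3 : (2 : ℝ) * (inner ℝ (b i) x ^ 2 + inner ℝ (b j) x ^ 2) ≠ 0 :=
    mul_ne_zero two_ne_zero hx.1.ne'
  exact (continuousAt_const.div h1 hx.1.ne').sub
    ((((h2.add continuousAt_const).sub continuousAt_const).div (continuousAt_const.mul h1) h3).pow 2)

theorem analyticAt_arm {L l σ : ℝ} {x : Rn n} (hx : IsArmRegular b i j L l x) :
    AnalyticAt ℝ (arm b i j L l σ) x := by
  have hX := analyticAt_inner_left (b i) x
  have hY := analyticAt_inner_left (b j) x
  have hρ := (hX.pow 2).add (hY.pow 2)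
  have hs := (((analyticAt_norm_sq x).add (analyticAt_const (v := L ^ 2))).sub
    (analyticAt_const (v := l ^ 2))).div ((analyticAt_const (v := (2 : ℝ))).mul hρ)
    (mul_ne_zero two_ne_zero hx.1.ne')
  have ht := (((analyticAt_const (v := L ^ 2)).div hρ hx.1.ne').sub (hs.pow 2)).sqrt_of_pos hx.2
  exact (((hs.mul hX).sub (((analyticAt_const (v := σ)).mul ht).mul hY)).smul analyticAt_const).add
    (((hs.mul hY).add (((analyticAt_const (v := σ)).mul ht).mul hX)).smul analyticAt_const)

/-- Fixed points the distances to which force a point into a circle in a plane through `o`. -/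
noncomputable def armCenter (b : OrthonormalBasis (Fin n) ℝ (Rn n)) (i j : Fin n) (o : Rn n)
    (k : Fin n) : Rn n :=
  if k = i ∨ k = j then o else o + b k

/-- The distances to the points `armCenter` that belong to the circle of radius `L`. -/
noncomputable def armLength (i j : Fin n) (L : ℝ) (k : Fin n) : ℝ :=
  if k = i ∨ k = j then L else √(L ^ 2 + 1)

theorem armLength_pos {L : ℝ} (hL : 0 < L) (k : Fin n) : 0 < armLength i j L k := by
  unfold armLength
  split_ifs <;> positivity

/-- Pythagoras: once the norm of `u` is known, orthogonality to a unit vector becomes a distance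
condition, so bars can express planarity in `ℝⁿ`. -/
theorem norm_sub_basis_iff {L : ℝ} {u : Rn n} (hu : ‖u‖ = L) (k : Fin n) :
    ‖u - b k‖ = √(L ^ 2 + 1) ↔ inner ℝ (b k) u = (0 : ℝ) := by
  have h : ‖u - b k‖ ^ 2 = L ^ 2 + 1 - 2 * inner ℝ (b k) u := by
    rw [norm_sub_sq_real, hu, b.norm_eq_one, real_inner_comm]; ring
  rw [eq_comm, Real.sqrt_eq_iff_eq_sq (by positivity) (norm_nonneg _), h]
  constructor <;> intro h <;> linarith

theorem dist_armCenter_iff {L : ℝ} (o u : Rn n) :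
    (∀ k, dist u (armCenter b i j o k) = armLength i j L k) ↔
      ‖u - o‖ = L ∧ ∀ k, k ≠ i → k ≠ j → inner ℝ (b k) (u - o) = (0 : ℝ) := by
  constructor
  · intro h
    have h1 := h i
    rw [armCenter, armLength, if_pos (Or.inl rfl), if_pos (Or.inl rfl), dist_eq_norm] at h1
    refine ⟨h1, fun k hi hj => ?_⟩
    have h2 := h k
    rwa [armCenter, armLength, if_neg (by tauto), if_neg (by tauto), dist_eq_norm, ← sub_sub,
      norm_sub_basis_iff b h1] at h2
  · rintro ⟨h1, h2⟩ k
    rw [armCenter, armLength, dist_eq_norm]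
    split_ifs with h
    · exact h1
    · rw [← sub_sub, norm_sub_basis_iff b h1]
      exact h2 k (by tauto) (by tauto)

theorem dist_arm_iff (hij : i ≠ j) {L l : ℝ} (hL : 0 ≤ L) (hl : 0 ≤ l) {o x : Rn n}
    (hx : IsArmRegular b i j L l (x - o)) (u : Rn n) :
    (dist u x = l ∧ ∀ k, dist u (armCenter b i j o k) = armLength i j L k) ↔
      u = o + arm b i j L l 1 (x - o) ∨ u = o + arm b i j L l (-1) (x - o) := by
  rw [dist_armCenter_iff, ← sub_eq_iff_eq_add', ← sub_eq_iff_eq_add', ← arm_iff b hij hL hl hx,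
    sub_sub_sub_cancel_right, dist_comm, dist_eq_norm]
  tauto

/-- The two bars and the segment from the origin form an equilateral triangle, so the arm is bent.
-/
theorem isArmRegular_smul (hij : i ≠ j) {r : ℝ} (hr : 0 < r) :
    IsArmRegular b i j r r (r • b i) := by
  have h1 : (inner ℝ (b i) (r • b i) : ℝ) = r := by simp [inner_smul_right]
  have h2 : (inner ℝ (b j) (r • b i) : ℝ) = 0 := by simp [inner_smul_right, b.inner_eq_ite, hij.symm]
  rw [IsArmRegular, h1, h2, norm_smul, b.norm_eq_one, Real.norm_of_nonneg hr.le]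
  have : r ^ 2 ≠ 0 := by positivity
  refine ⟨by positivity, ?_⟩
  have e : r ^ 2 / (r ^ 2 + 0 ^ 2) - (((r * 1) ^ 2 + r ^ 2 - r ^ 2) / (2 * (r ^ 2 + 0 ^ 2))) ^ 2
    = 3 / 4 := by field_simp; ring
  rw [e]; norm_num

end Arm

/-! ### Tethering vertices near a given configuration. -/

section Restrict

variable {n : ℕ}

/-- A linkage that keeps a point near `x₀`. -/
theorem linkGermIn_point (hn : 2 ≤ n) (x₀ : Unit → Rn n) {δ : ℝ} (hδ : 0 < δ) :
    LinkGermIn univ {x | dist (x ()) (x₀ ()) < δ} x₀ := by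
  let b := EuclideanSpace.basisFun (Fin n) ℝ
  let i : Fin n := ⟨0, by lia⟩
  let j : Fin n := ⟨1, by lia⟩
  have hij : i ≠ j := by simp [i, j]
  -- The tether starts at distance `r` from `x₀` and has two bars of length `r`, so its end stays
  -- within `3 * r < δ` of `x₀`.
  set r := δ / 4 with hr
  have hr0 : 0 < r := by positivity
  set o := x₀ () - r • b i with ho
  have hreg : IsArmRegular b i j r r (x₀ () - o) := by
    rw [ho, sub_sub_cancel]; exact isArmRegular_smul b hij hr0
  have hev : AnalyticAt ℝ (fun x : Unit → Rn n => x () - o) x₀ :=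
    ((ContinuousLinearMap.proj (R := ℝ) (φ := fun _ : Unit => Rn n) ()).analyticAt x₀).sub
      analyticAt_const
  let σ : Bool → ℝ := fun f => if f then 1 else -1
  let S : Set (Unit ⊕ Option (Fin n) → Rn n) :=
    {φ | dist (φ (.inr none)) (φ (.inl ())) = r} ∩
    ({φ | ∀ k, dist (φ (.inr none)) (φ (.inr (some k))) = armLength i j r k} ∩
    {φ | ∀ k, φ (.inr (some k)) = armCenter b i j o k})
  refine ⟨Option (Fin n), inferInstance, Bool, inferInstance, inferInstance, S,
    fun f x => fun k => k.elim (o + arm b i j r r (σ f) (x () - o)) (armCenter b i j o), ?_, ?_, ?_,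
    ?_, ?_⟩
  · exact (isConfig_dist _ _ hr0).inter
      ((isConfig_forall fun k => isConfig_dist _ _ (armLength_pos hr0 k)).inter
        (isConfig_forall fun k => isConfig_pin _ _))
  · rintro φ ⟨h1 : dist _ _ = r, h2, h3⟩
    have h4 : ‖φ (.inr none) - o‖ = r :=
      ((dist_armCenter_iff b o _).1 fun k => by rw [← h3 k]; exact h2 k).1
    have h5 : dist o (x₀ ()) = r := by
      rw [ho, dist_eq_norm, sub_sub_cancel_left, norm_neg, norm_smul, b.norm_eq_one,
        Real.norm_of_nonneg hr0.le, mul_one]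
    have h6 := dist_triangle4 (φ (.inl ())) (φ (.inr none)) o (x₀ ())
    rw [dist_comm (φ (.inl ())) (φ (.inr none)), h1, dist_eq_norm _ o, h4, h5] at h6
    show dist (φ (.inl ())) (x₀ ()) < δ
    linarith
  · intro f
    refine AnalyticAt.pi fun k => ?_
    cases k with
    | none =>
      have := (analyticAt_arm b (σ := σ f) hreg).comp_of_eq hev rfl
      exact analyticAt_const.add this
    | some k => exact analyticAt_const
  · intro f g hfg
    have h := add_left_cancel (congrFun hfg none)
    have := arm_ne b hij hreg
    cases f <;> cases g <;> simp only [σ] at h <;> simp_all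
  · filter_upwards [hev.continuousAt.eventually (eventually_isArmRegular b hreg)] with x hx y
    have key := dist_arm_iff b hij hr0.le hr0.le hx
    simp only [mem_univ, true_and]
    constructor
    · rintro ⟨h1, h2, h3⟩
      rcases (key (y none)).1 ⟨h1, fun k => by rw [← h3 k]; exact h2 k⟩ with h | h
      · refine ⟨true, funext fun k => ?_⟩
        cases k with
        | none => exact h
        | some k => exact h3 k
      · refine ⟨false, funext fun k => ?_⟩
        cases k with
        | none => exact h
        | some k => exact h3 k
    · rintro ⟨f, rfl⟩
      have h := (key (o + arm b i j r r (σ f) (x () - o))).2 (by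
        cases f
        · exact Or.inr rfl
        · exact Or.inl rfl)
      exact ⟨h.1, h.2, fun _ => rfl⟩

variable {ι κ : Type} [Fintype ι] [Fintype κ]

/-- A linkage that keeps finitely many points near a given configuration. -/
theorem linkGermIn_nhds (hn : 2 ≤ n) {x₀ : ι → Rn n} {U : Set (ι → Rn n)} (hU : U ∈ 𝓝 x₀) :
    LinkGermIn univ U x₀ := by
  obtain ⟨δ, hδ, hU⟩ := Metric.mem_nhds_iff.1 hU
  have h : ∀ i : ι, LinkGermIn {x : ι → Rn n | True} {x | dist (x i) (x₀ i) < δ} x₀ := fun i =>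
    (linkGermIn_point hn (fun _ => x₀ i) hδ).comap (fun _ => i) rfl
  refine ((linkGermIn_forall h).congr (R' := univ) (by simp)).mono fun x hx => hU ?_
  rw [Metric.mem_ball, dist_pi_lt_iff hδ]
  exact hx

/-- Configurations can be restricted to those over any neighbourhood, and then all lie over `R`. -/
theorem LinkGerm.localize (hn : 2 ≤ n) {R U : Set (ι → Rn n)} {x₀ : ι → Rn n} (h : LinkGerm R x₀)
    (hU : U ∈ 𝓝 x₀) : LinkGermIn R (R ∩ U) x₀ := by
  obtain ⟨κ, _, N, _, _, S, α, h1, h2, h3, h4, h5⟩ := h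
  -- Only over `U₀` is the linkage known to enforce `R`. A tether into `U ∩ U₀` discards everything
  -- else.
  set U₀ := {x | ∀ y, Sum.elim x y ∈ S ↔ x ∈ R ∧ ∃ f, y = α f x}
  have h' : LinkGermIn R {x | x ∈ U₀ → x ∈ R} x₀ := by
    refine ⟨κ, inferInstance, N, inferInstance, ‹_›, S, α, h1, fun φ hφ hU => ?_, h3, h4, h5⟩
    rw [← Sum.elim_comp_inl_inr φ] at hφ
    exact ((hU _).1 hφ).1
  refine ((h'.inter (linkGermIn_nhds hn (inter_mem hU h5))).congr (by simp)).mono ?_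
  exact fun x hx => ⟨hx.1 hx.2.2, hx.2.1⟩

end Restrict

/-! ### Functions computed by linkages near a configuration. -/

section Constructible

variable {n : ℕ} {ι J K : Type} [Fintype ι] [Fintype J] [Fintype K]

/-- Near `x₀`, the function `f` is the position of a vertex of a linkage whose additional vertices
are analytic functions of the given ones. -/
def ConstructibleAt (f : (ι → Rn n) → Rn n) (x₀ : ι → Rn n) : Prop :=
  ∃ (κ : Type) (_ : Fintype κ) (β : (ι → Rn n) → κ → Rn n) (v : ι ⊕ κ), AnalyticAt ℝ β x₀ ∧
    LinkGerm {z : ι ⊕ κ → Rn n | z ∘ Sum.inr = β (z ∘ Sum.inl)} (Sum.elim x₀ (β x₀)) ∧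
    ∀ᶠ x in 𝓝 x₀, f x = Sum.elim x (β x) v

variable {x₀ : ι → Rn n}

/-- One linkage, with the disjoint union of the auxiliary vertices, computes finitely many
constructible functions simultaneously. -/
theorem exists_extension {h : J → (ι → Rn n) → Rn n} (hh : ∀ j, ConstructibleAt (h j) x₀) :
    ∃ (κ : Type) (_ : Fintype κ) (β : (ι → Rn n) → κ → Rn n) (v : J → ι ⊕ κ), AnalyticAt ℝ β x₀ ∧
      LinkGerm {z : ι ⊕ κ → Rn n | z ∘ Sum.inr = β (z ∘ Sum.inl)} (Sum.elim x₀ (β x₀)) ∧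
      ∀ᶠ x in 𝓝 x₀, ∀ j, h j x = Sum.elim x (β x) (v j) := by
  choose κ inst β v h1 h2 h3 using hh
  refine ⟨Σ j, κ j, inferInstance, fun x k => β k.1 x k.2,
    fun j => Sum.map id (fun k => ⟨j, k⟩) (v j),
    AnalyticAt.pi fun k => analyticAt_pi_iff.1 (h1 k.1) k.2, ?_, ?_⟩
  · have h4 : ∀ j, LinkGerm {z : ι ⊕ (Σ j, κ j) → Rn n |
        (fun k => z (.inr ⟨j, k⟩)) = β j (z ∘ Sum.inl)}
        (Sum.elim x₀ (fun k => β k.1 x₀ k.2)) := fun j =>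
      (h2 j).comap (Sum.map id (fun k => (⟨j, k⟩ : Σ j, κ j))) (by ext (i | i) <;> rfl)
    refine (linkGerm_forall h4).congr (Eventually.of_forall fun z => ?_)
    simp only [mem_ofPred_eq, funext_iff, Sigma.forall, Function.comp_apply]
  · rw [eventually_all]
    intro j
    filter_upwards [h3 j] with x hx
    rw [hx]
    cases v j <;> rfl

/-- A position which is determined by a linkage on constructible vertices is constructible. -/
theorem constructibleAt_implicit {h : J → (ι → Rn n) → Rn n} (hh : ∀ j, ConstructibleAt (h j) x₀)
    {R : Set (J ⊕ K → Rn n)} {β : (ι → Rn n) → K → Rn n} (hβ : AnalyticAt ℝ β x₀)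
    (hR : LinkGerm R (Sum.elim (fun j => h j x₀) (β x₀)))
    (heq : ∀ᶠ p : (ι → Rn n) × (K → Rn n) in 𝓝 (x₀, β x₀),
      Sum.elim (fun j => h j p.1) p.2 ∈ R ↔ p.2 = β p.1) (k : K) :
    ConstructibleAt (fun x => β x k) x₀ := by
  obtain ⟨κ, _, γ, v, h1, h2, h3⟩ := exists_extension hh
  refine ⟨κ ⊕ K, inferInstance, fun x => Sum.elim (γ x) (β x), .inr (.inr k), h1.sumElim hβ, ?_,
    Eventually.of_forall fun x => rfl⟩
  have hA := h2.comap (κ := ι ⊕ (κ ⊕ K)) (Sum.map id Sum.inl)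
    (x₀ := Sum.elim x₀ (Sum.elim (γ x₀) (β x₀))) (by ext (i | i) <;> rfl)
  -- When the auxiliary vertices sit at `γ`, those selected by `v` sit at the values of `h`, so the
  -- pulled-back `R` really relates the new vertices to `h`.
  have key : ∀ z : ι ⊕ (κ ⊕ K) → Rn n,
      (∀ j, h j (z ∘ .inl) = Sum.elim (z ∘ .inl) (γ (z ∘ .inl)) (v j)) →
      z ∘ .inr ∘ .inl = γ (z ∘ .inl) →
      z ∘ Sum.elim (Sum.map id Sum.inl ∘ v) (Sum.inr ∘ Sum.inr) =
        Sum.elim (fun j => h j (z ∘ .inl)) (z ∘ .inr ∘ .inr) := by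
    intro z hz hc
    ext1 (j | j)
    · simp only [Function.comp_apply, Sum.elim_inl, hz, ← hc]
      cases v j <;> rfl
    · rfl
  have hB := hR.comap (κ := ι ⊕ (κ ⊕ K)) (Sum.elim (Sum.map id Sum.inl ∘ v) (Sum.inr ∘ Sum.inr))
    (x₀ := Sum.elim x₀ (Sum.elim (γ x₀) (β x₀))) (key _ h3.self_of_nhds rfl)
  refine (hA.inter hB).congr ?_
  have c1 : ContinuousAt (fun z : ι ⊕ (κ ⊕ K) → Rn n => z ∘ Sum.inl)
    (Sum.elim x₀ (Sum.elim (γ x₀) (β x₀))) := (analyticAt_comp_index _ _).continuousAt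
  have c2 : ContinuousAt (fun z : ι ⊕ (κ ⊕ K) → Rn n => z ∘ Sum.inr ∘ Sum.inr)
    (Sum.elim x₀ (Sum.elim (γ x₀) (β x₀))) := (analyticAt_comp_index _ _).continuousAt
  filter_upwards [c1.eventually h3, (c1.prodMk c2).eventually heq] with z hz hz'
  constructor
  · rintro ⟨ha, hb⟩
    have ha' : z ∘ .inr ∘ .inl = γ (z ∘ .inl) := ha
    have hb' : z ∘ Sum.elim (Sum.map id Sum.inl ∘ v) (Sum.inr ∘ Sum.inr) ∈ R := hb
    rw [key z hz ha'] at hb'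
    have hc := hz'.1 hb'
    ext1 (j | j)
    · exact congrFun ha' j
    · exact congrFun hc j
  · intro hz2
    have ha : z ∘ .inr ∘ .inl = γ (z ∘ .inl) := funext fun j => congrFun hz2 (.inl j)
    refine ⟨ha, ?_⟩
    show z ∘ Sum.elim (Sum.map id Sum.inl ∘ v) (Sum.inr ∘ Sum.inr) ∈ R
    rw [key z hz ha]
    exact hz'.2 (funext fun j => congrFun hz2 (.inr j))

/-- The pullback of a germ along constructible functions. -/
theorem LinkGerm.comp (hn : 2 ≤ n) {R : Set (J → Rn n)} {h : J → (ι → Rn n) → Rn n}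
    (hR : LinkGerm R (fun j => h j x₀)) (hh : ∀ j, ConstructibleAt (h j) x₀) :
    LinkGerm {x | (fun j => h j x) ∈ R} x₀ := by
  obtain ⟨κ, _, γ, v, h1, h2, h3⟩ := exists_extension hh
  have hv : Sum.elim x₀ (γ x₀) ∘ v = fun j => h j x₀ := funext fun j => (h3.self_of_nhds j).symm
  -- Localizing forces every configuration to lie over the graph of `γ`, which is what allows those
  -- vertices to become auxiliary.
  have h4 := ((h2.inter (hR.comap v hv)).localize hn univ_mem).elim h1
    (Eventually.of_forall fun x y hy => hy.1.1)
  refine h4.congr ?_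
  filter_upwards [h3] with x hx
  have : (fun j => h j x) = Sum.elim x (γ x) ∘ v := funext hx
  show (_ ∧ Sum.elim x (γ x) ∘ v ∈ R) ↔ (fun j => h j x) ∈ R
  rw [this]
  exact ⟨fun h => h.2, fun h => ⟨rfl, h⟩⟩

theorem ConstructibleAt.congr {f g : (ι → Rn n) → Rn n} (hf : ConstructibleAt f x₀)
    (hfg : ∀ᶠ x in 𝓝 x₀, f x = g x) : ConstructibleAt g x₀ := by
  obtain ⟨κ, _, β, v, h1, h2, h3⟩ := hf
  refine ⟨κ, inferInstance, β, v, h1, h2, ?_⟩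
  filter_upwards [h3, hfg] with x hx hx'
  rw [← hx', hx]

theorem ConstructibleAt.analyticAt {f : (ι → Rn n) → Rn n} (hf : ConstructibleAt f x₀) :
    AnalyticAt ℝ f x₀ := by
  obtain ⟨κ, _, β, v, h1, h2, h3⟩ := hf
  refine AnalyticAt.congr ?_ (h3.mono fun x hx => hx.symm)
  exact analyticAt_pi_iff.1 ((analyticAt_id (𝕜 := ℝ)).sumElim h1) v

theorem constructibleAt_apply (i : ι) : ConstructibleAt (fun x => x i) x₀ := by
  refine ⟨Empty, inferInstance, fun _ => Empty.elim, .inl i, analyticAt_const, ?_,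
    Eventually.of_forall fun x => rfl⟩
  refine (isConfig_univ.linkGerm _).congr (Eventually.of_forall fun z => ?_)
  exact ⟨fun _ => Subsingleton.elim _ _, fun _ => trivial⟩

theorem constructibleAt_const (c : Rn n) : ConstructibleAt (fun _ => c) x₀ := by
  refine ⟨Unit, inferInstance, fun _ _ => c, .inr (), analyticAt_const, ?_,
    Eventually.of_forall fun x => rfl⟩
  refine ((isConfig_pin (.inr ()) c).linkGerm _).congr (Eventually.of_forall fun z => ?_)
  exact ⟨fun h => funext fun _ => h, fun h => congrFun h ()⟩

/-- The joint of an arm is constructible. -/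
theorem ConstructibleAt.arm (b : OrthonormalBasis (Fin n) ℝ (Rn n)) {i j : Fin n} (hij : i ≠ j)
    {L l : ℝ} (hL : 0 < L) (hl : 0 < l) {f : (ι → Rn n) → Rn n} (hf : ConstructibleAt f x₀)
    {o : Rn n} (hreg : IsArmRegular b i j L l (f x₀ - o)) {σ : ℝ} (hσ : σ = 1 ∨ σ = -1) :
    ConstructibleAt (fun x => o + arm b i j L l σ (f x - o)) x₀ := by
  have hev : AnalyticAt ℝ (fun x => f x - o) x₀ := hf.analyticAt.sub analyticAt_const
  have ha : ∀ τ, AnalyticAt ℝ (fun x => o + _root_.arm b i j L l τ (f x - o)) x₀ := fun τ =>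
    analyticAt_const.add ((analyticAt_arm b (σ := τ) hreg).comp_of_eq hev rfl)
  refine constructibleAt_implicit (J := Option (Fin n)) (K := Unit)
    (h := fun a => a.elim f (fun k _ => armCenter b i j o k))
    (R := {z | dist (z (.inr ())) (z (.inl none)) = l} ∩
      {z | ∀ k, dist (z (.inr ())) (z (.inl (some k))) = armLength i j L k})
    (β := fun x _ => o + _root_.arm b i j L l σ (f x - o)) ?_ (AnalyticAt.pi fun _ => ha σ) ?_ ?_ ()
  · rintro (_ | k)
    · exact hf
    · exact constructibleAt_const _
  · exact ((isConfig_dist _ _ hl).inter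
      (isConfig_forall fun k => isConfig_dist _ _ (armLength_pos hL k))).linkGerm _
  -- The other elbow position is a different point, so closeness to the base configuration excludes
  -- it and the joint is determined.
  · have hne : o + _root_.arm b i j L l σ (f x₀ - o) ≠ o + _root_.arm b i j L l (-σ) (f x₀ - o) := by
      have := arm_ne b hij hreg
      rcases hσ with rfl | rfl
      · simpa using this
      · simpa using this.symm
    have c1 : Tendsto (fun p : (ι → Rn n) × (Unit → Rn n) => p.1)
      (𝓝 (x₀, fun _ => o + _root_.arm b i j L l σ (f x₀ - o))) (𝓝 x₀) := continuousAt_fst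
    have c2 : Tendsto (fun p : (ι → Rn n) × (Unit → Rn n) => p.2 ())
      (𝓝 (x₀, fun _ => o + _root_.arm b i j L l σ (f x₀ - o)))
      (𝓝 (o + _root_.arm b i j L l σ (f x₀ - o))) :=
      ((continuous_apply ()).comp continuous_snd).continuousAt
    have c3 := (c2.sub ((ha (-σ)).continuousAt.tendsto.comp c1)).eventually_ne (sub_ne_zero.2 hne)
    filter_upwards [c1.eventually (hev.continuousAt.eventually (eventually_isArmRegular b hreg)), c3]
      with p hp hp'
    have key := dist_arm_iff b hij hL.le hl.le hp (p.2 ())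
    have e : (o + _root_.arm b i j L l 1 (f p.1 - o) = p.2 () ∨
      o + _root_.arm b i j L l (-1) (f p.1 - o) = p.2 ()) ↔
      p.2 () = o + _root_.arm b i j L l σ (f p.1 - o) := by
      rw [sub_ne_zero, Function.comp_apply] at hp'
      rcases hσ with rfl | rfl
      · rw [or_iff_left (Ne.symm hp'), eq_comm]
      · rw [neg_neg] at hp'
        rw [or_iff_right (Ne.symm hp'), eq_comm]
    have e' : p.2 = (fun _ => o + _root_.arm b i j L l σ (f p.1 - o)) ↔
      p.2 () = o + _root_.arm b i j L l σ (f p.1 - o) :=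
      ⟨fun h => congrFun h (), fun h => funext fun _ => h⟩
    rw [e', ← e, @eq_comm _ _ (p.2 ()), @eq_comm _ _ (p.2 ()), ← key]
    rfl

/-- A function is constructible as a sum of two bars. -/
theorem ConstructibleAt.split (hn : 2 ≤ n) {f : (ι → Rn n) → Rn n} (hf : ConstructibleAt f x₀) :
    ∃ (o : Rn n) (u : (ι → Rn n) → Rn n), ConstructibleAt u x₀ ∧
      ∀ᶠ x in 𝓝 x₀, dist (u x) o = 1 ∧ dist (u x) (f x) = 1 := by
  let b := EuclideanSpace.basisFun (Fin n) ℝ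
  let i : Fin n := ⟨0, by lia⟩
  let j : Fin n := ⟨1, by lia⟩
  have hij : i ≠ j := by simp [i, j]
  -- At unit distance from `f x₀` the arm with two unit bars is bent, hence regular.
  set o := f x₀ - (1 : ℝ) • b i with ho
  have hreg : IsArmRegular b i j 1 1 (f x₀ - o) := by
    rw [ho, sub_sub_cancel]; exact isArmRegular_smul b hij one_pos
  refine ⟨o, _, hf.arm b hij one_pos one_pos hreg (Or.inl rfl), ?_⟩
  have hev : ContinuousAt (fun x => f x - o) x₀ :=
    (hf.analyticAt.sub analyticAt_const).continuousAt
  filter_upwards [hev.eventually (eventually_isArmRegular b hreg)] with x hx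
  have h := (dist_arm_iff b hij zero_le_one zero_le_one hx _).2 (Or.inl rfl)
  refine ⟨?_, h.1⟩
  rw [dist_eq_norm]
  exact ((dist_armCenter_iff b o _).1 h.2).1

end Constructible

/-! ### Vector addition and scaling by braced parallelograms. -/

section Linear

variable {n : ℕ} {ι : Type} [Fintype ι] {x₀ : ι → Rn n}

/-- The prescribed distances are those of a degenerate triangle; expanding them gives `‖(y - p) - t
• (q - p)‖ = 0`. Thus two bars attach a point rigidly to the line of a bar. -/
theorem eq_add_smul_sub_of_dist {p q y : Rn n} {a t : ℝ} (ha : dist p q = a)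
    (h1 : dist y p = |t| * a) (h2 : dist y q = |1 - t| * a) : y = p + t • (q - p) := by
  rw [dist_eq_norm] at h1 h2
  rw [dist_comm, dist_eq_norm] at ha
  have e1 : ‖y - p‖ ^ 2 = t ^ 2 * a ^ 2 := by rw [h1, mul_pow, sq_abs]
  have e2 : ‖(y - p) - (q - p)‖ ^ 2 = (1 - t) ^ 2 * a ^ 2 := by
    rw [sub_sub_sub_cancel_right, h2, mul_pow, sq_abs]
  rw [norm_sub_sq_real, e1, ha] at e2
  have e3 : ‖(y - p) - t • (q - p)‖ ^ 2 = 0 := by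
    rw [norm_sub_sq_real, e1, inner_smul_right, norm_smul, ha, mul_pow, Real.norm_eq_abs, sq_abs]
    linear_combination t * e2
  rw [sq_eq_zero_iff, norm_eq_zero, sub_eq_zero] at e3
  rw [← e3, add_sub_cancel]

theorem dist_add_smul_sub {p q : Rn n} {a : ℝ} (ha : dist p q = a) (t : ℝ) :
    dist (p + t • (q - p)) p = |t| * a ∧ dist (p + t • (q - p)) q = |1 - t| * a := by
  rw [dist_eq_norm, dist_eq_norm, add_sub_cancel_left, norm_smul, Real.norm_eq_abs, ← dist_eq_norm,
    dist_comm, ha]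
  have : p + t • (q - p) - q = (1 - t) • (p - q) := by module
  rw [this, norm_smul, Real.norm_eq_abs, ← dist_eq_norm, ha]
  exact ⟨rfl, rfl⟩

/-- The brace joins the midpoints of `AB` and `DC`. It is the mean of `D - A` and `C - B`, and all
three have length `b`, so by the parallelogram law the two are equal. This rules out the
antiparallelogram. -/
theorem parallelogram_eq {A B C D : Rn n} {b : ℝ} (h1 : dist A D = b) (h2 : dist C B = b)
    (h3 : dist (D + (2⁻¹ : ℝ) • (C - D)) (A + (2⁻¹ : ℝ) • (B - A)) = b) : C = B + D - A := by
  rw [dist_eq_norm] at h2 h3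
  rw [dist_comm, dist_eq_norm] at h1
  have e : D + (2⁻¹ : ℝ) • (C - D) - (A + (2⁻¹ : ℝ) • (B - A)) =
    (2⁻¹ : ℝ) • ((D - A) + (C - B)) := by module
  rw [e, norm_smul, Real.norm_of_nonneg (by norm_num)] at h3
  have h4 := parallelogram_law_with_norm ℝ (D - A) (C - B)
  have h5 : ‖(D - A) + (C - B)‖ = 2 * b := by linarith
  rw [h1, h2, h5] at h4
  have h6 : ‖D - A - (C - B)‖ = 0 := by
    have : ‖D - A - (C - B)‖ * ‖D - A - (C - B)‖ = 0 := by linarith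
    exact mul_self_eq_zero.1 this
  rw [norm_eq_zero, sub_eq_zero] at h6
  rw [add_sub_assoc, h6, add_sub_cancel]

namespace ConstructibleAt

theorem on_bar {f g : (ι → Rn n) → Rn n} (hf : ConstructibleAt f x₀) (hg : ConstructibleAt g x₀)
    {a : ℝ} (ha : 0 < a) (hfg : ∀ᶠ x in 𝓝 x₀, dist (f x) (g x) = a) (t : ℝ) :
    ConstructibleAt (fun x => f x + t • (g x - f x)) x₀ := by
  -- For `t = 0` or `t = 1` one of the bars would have length zero.
  rcases eq_or_ne t 0 with rfl | h0
  · simpa using hf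
  rcases eq_or_ne t 1 with rfl | h1
  · simpa using hg
  have h1' : 1 - t ≠ 0 := sub_ne_zero.2 h1.symm
  refine constructibleAt_implicit (J := Bool) (K := Unit) (h := fun c => if c then g else f)
    (R := {z | dist (z (.inr ())) (z (.inl false)) = |t| * a} ∩
      {z | dist (z (.inr ())) (z (.inl true)) = |1 - t| * a})
    (β := fun x _ => f x + t • (g x - f x)) ?_ (AnalyticAt.pi fun _ => ?_) ?_ ?_ ()
  · rintro (_ | _)
    · exact hf
    · exact hg
  · have h1 := hf.analyticAt
    have h2 := hg.analyticAt
    fun_prop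
  · exact ((isConfig_dist _ _ (by positivity)).inter (isConfig_dist _ _ (by positivity))).linkGerm _
  · filter_upwards [continuousAt_fst.eventually hfg] with p hp
    constructor
    · rintro ⟨e1, e2⟩
      exact funext fun _ => eq_add_smul_sub_of_dist hp e1 e2
    · intro h
      rw [h]
      exact dist_add_smul_sub hp t

theorem parallelogram {f g k : (ι → Rn n) → Rn n} (hf : ConstructibleAt f x₀)
    (hg : ConstructibleAt g x₀) (hk : ConstructibleAt k x₀) {a b : ℝ}
    (hfg : ∀ᶠ x in 𝓝 x₀, dist (f x) (g x) = a) (hfk : ∀ᶠ x in 𝓝 x₀, dist (f x) (k x) = b) :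
    ConstructibleAt (fun x => g x + k x - f x) x₀ := by
  have ha : 0 ≤ a := hfg.self_of_nhds ▸ dist_nonneg
  have hb : 0 ≤ b := hfk.self_of_nhds ▸ dist_nonneg
  rcases ha.eq_or_lt with rfl | ha
  · refine hk.congr ?_
    filter_upwards [hfg] with x hx
    rw [dist_eq_zero.1 hx, add_sub_cancel_left]
  rcases hb.eq_or_lt with rfl | hb
  · refine hg.congr ?_
    filter_upwards [hfk] with x hx
    rw [dist_eq_zero.1 hx, add_sub_cancel_right]
  have hm := hf.on_bar hg ha hfg 2⁻¹
  have h2 : |(2⁻¹ : ℝ)| = 2⁻¹ := abs_of_pos (by norm_num)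
  have h2' : |1 - (2⁻¹ : ℝ)| = 2⁻¹ := by norm_num
  refine constructibleAt_implicit (J := Fin 4) (K := Bool)
    (h := ![f, g, k, fun x => f x + (2⁻¹ : ℝ) • (g x - f x)])
    (R := ({z | dist (z (.inr true)) (z (.inl 2)) = a} ∩
      {z | dist (z (.inr true)) (z (.inl 1)) = b}) ∩
      ({z | dist (z (.inr false)) (z (.inl 2)) = 2⁻¹ * a} ∩
      {z | dist (z (.inr false)) (z (.inr true)) = 2⁻¹ * a} ∩
      {z | dist (z (.inr false)) (z (.inl 3)) = b}))
    (β := fun x c => if c then g x + k x - f x else k x + (2⁻¹ : ℝ) • (g x - f x))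
    ?_ (AnalyticAt.pi fun c => ?_) ?_ ?_ true
  · intro c
    fin_cases c
    exacts [hf, hg, hk, hm]
  · have h1 := hf.analyticAt
    have h2 := hg.analyticAt
    have h3 := hk.analyticAt
    cases c
    · simp only [Bool.false_eq_true, if_false]
      fun_prop
    · simp only [if_true]
      fun_prop
  · exact (((isConfig_dist _ _ ha).inter (isConfig_dist _ _ hb)).inter
      (((isConfig_dist _ _ (by positivity)).inter (isConfig_dist _ _ (by positivity))).inter
        (isConfig_dist _ _ hb))).linkGerm _
  · filter_upwards [continuousAt_fst.eventually hfg, continuousAt_fst.eventually hfk] with p hp hp'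
    constructor
    · rintro ⟨⟨e1, e2⟩, ⟨e3, e4⟩, e5⟩
      change dist (p.2 true) (k p.1) = a at e1
      change dist (p.2 true) (g p.1) = b at e2
      change dist (p.2 false) (k p.1) = 2⁻¹ * a at e3
      change dist (p.2 false) (p.2 true) = 2⁻¹ * a at e4
      change dist (p.2 false) (f p.1 + (2⁻¹ : ℝ) • (g p.1 - f p.1)) = b at e5
      have hN := eq_add_smul_sub_of_dist (p := k p.1) (q := p.2 true) (a := a) (t := 2⁻¹)
        (by rw [dist_comm]; exact e1)
        (by rw [h2]; exact e3) (by rw [h2']; exact e4)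
      rw [hN] at e5
      have hC := parallelogram_eq hp' e2 e5
      funext c
      cases c
      · rw [hN, hC]
        simp only [Bool.false_eq_true, if_false]
        module
      · exact hC
    · intro h
      rw [h]
      show ((dist (g p.1 + k p.1 - f p.1) (k p.1) = a ∧ dist (g p.1 + k p.1 - f p.1) (g p.1) = b) ∧
        (dist (k p.1 + (2⁻¹ : ℝ) • (g p.1 - f p.1)) (k p.1) = 2⁻¹ * a ∧
        dist (k p.1 + (2⁻¹ : ℝ) • (g p.1 - f p.1)) (g p.1 + k p.1 - f p.1) = 2⁻¹ * a) ∧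
        dist (k p.1 + (2⁻¹ : ℝ) • (g p.1 - f p.1)) (f p.1 + (2⁻¹ : ℝ) • (g p.1 - f p.1)) = b)
      have n1 : ‖g p.1 - f p.1‖ = a := by rw [← dist_eq_norm, dist_comm, hp]
      have n2 : ‖k p.1 - f p.1‖ = b := by rw [← dist_eq_norm, dist_comm, hp']
      simp only [dist_eq_norm]
      have q1 : g p.1 + k p.1 - f p.1 - k p.1 = g p.1 - f p.1 := by abel
      have q2 : g p.1 + k p.1 - f p.1 - g p.1 = k p.1 - f p.1 := by abel
      have q3 : k p.1 + (2⁻¹ : ℝ) • (g p.1 - f p.1) - (g p.1 + k p.1 - f p.1) =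
        -((2⁻¹ : ℝ) • (g p.1 - f p.1)) := by module
      rw [q1, q2, q3, add_sub_cancel_left, add_sub_add_right_eq_sub, norm_neg, norm_smul, n1, n2,
        Real.norm_eq_abs, h2]
      simp

/-- A bar can be translated to any constructible vertex. -/
theorem add_bar (hn : 2 ≤ n) {f p q : (ι → Rn n) → Rn n} (hf : ConstructibleAt f x₀)
    (hp : ConstructibleAt p x₀) (hq : ConstructibleAt q x₀) {a : ℝ}
    (hpq : ∀ᶠ x in 𝓝 x₀, dist (p x) (q x) = a) :
    ConstructibleAt (fun x => f x + (q x - p x)) x₀ := by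
  -- A parallelogram carries the vector `q - p` from one end of a bar to the other. It is carried
  -- along the path `p, u, o, o', u', f`, in which consecutive points have constant distance.
  have step : ∀ {r s : (ι → Rn n) → Rn n} {c : ℝ}, ConstructibleAt r x₀ → ConstructibleAt s x₀ →
      (∀ᶠ x in 𝓝 x₀, dist (r x) (s x) = c) → ConstructibleAt (fun x => r x + (q x - p x)) x₀ →
      ConstructibleAt (fun x => s x + (q x - p x)) x₀ := by
    intro r s c hr hs hrs h
    have h1 : ∀ᶠ x in 𝓝 x₀, dist (r x) (r x + (q x - p x)) = a := by
      filter_upwards [hpq] with x hx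
      rw [dist_self_add_right, ← dist_eq_norm, dist_comm, hx]
    refine (hr.parallelogram hs h hrs h1).congr (Eventually.of_forall fun x => ?_)
    abel
  obtain ⟨o, u, hu, hou⟩ := hp.split hn
  obtain ⟨o', u', hu', hou'⟩ := hf.split hn
  have h0 : ConstructibleAt (fun x => p x + (q x - p x)) x₀ := by simpa using hq
  have h1 := step hp hu (hou.mono fun x hx => by rw [dist_comm]; exact hx.2) h0
  have h2 := step hu (constructibleAt_const o) (hou.mono fun x hx => hx.1) h1
  have h3 := step (constructibleAt_const o) (constructibleAt_const o')
    (Eventually.of_forall fun x => rfl) h2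
  have h4 := step (constructibleAt_const o') hu'
    (hou'.mono fun x hx => by rw [dist_comm]; exact hx.1) h3
  exact step hu' hf (hou'.mono fun x hx => hx.2) h4

/-- Even when the distance from `p` to `q` varies, `q - p` is the sum of the vectors of constant
length along `p, u, o, o', u', q`, which can be added one at a time. -/
theorem add_sub' (hn : 2 ≤ n) {f p q : (ι → Rn n) → Rn n} (hf : ConstructibleAt f x₀)
    (hp : ConstructibleAt p x₀) (hq : ConstructibleAt q x₀) :
    ConstructibleAt (fun x => f x + (q x - p x)) x₀ := by
  obtain ⟨o, u, hu, hou⟩ := hp.split hn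
  obtain ⟨o', u', hu', hou'⟩ := hq.split hn
  have h1 := hf.add_bar hn hp hu (hou.mono fun x hx => by rw [dist_comm]; exact hx.2)
  have h2 := h1.add_bar hn hu (constructibleAt_const o) (hou.mono fun x hx => hx.1)
  have h3 := h2.add_bar hn (constructibleAt_const o) (constructibleAt_const o')
    (Eventually.of_forall fun x => rfl)
  have h4 := h3.add_bar hn (constructibleAt_const o') hu'
    (hou'.mono fun x hx => by rw [dist_comm]; exact hx.1)
  have h5 := h4.add_bar hn hu' hq (hou'.mono fun x hx => hx.2)
  exact h5.congr (Eventually.of_forall fun x => by abel)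

theorem add (hn : 2 ≤ n) {f g : (ι → Rn n) → Rn n} (hf : ConstructibleAt f x₀)
    (hg : ConstructibleAt g x₀) : ConstructibleAt (fun x => f x + g x) x₀ := by
  simpa using hf.add_sub' hn (constructibleAt_const 0) hg

theorem sub (hn : 2 ≤ n) {f g : (ι → Rn n) → Rn n} (hf : ConstructibleAt f x₀)
    (hg : ConstructibleAt g x₀) : ConstructibleAt (fun x => f x - g x) x₀ := by
  simpa [sub_eq_add_neg] using hf.add_sub' hn hg (constructibleAt_const 0)

theorem const_smul (hn : 2 ≤ n) {f : (ι → Rn n) → Rn n} (hf : ConstructibleAt f x₀) (t : ℝ) :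
    ConstructibleAt (fun x => t • f x) x₀ := by
  -- Scaling works on each of the two bars from `o` to `u` and from `u` to `f`; the results are
  -- added and the constant offset is corrected.
  obtain ⟨o, u, hu, hou⟩ := hf.split hn
  have h1 := (constructibleAt_const o).on_bar hu one_pos
    (hou.mono fun x hx => by rw [dist_comm]; exact hx.1) t
  have h2 := hu.on_bar hf one_pos (hou.mono fun x hx => hx.2) t
  exact (h1.add_sub' hn (hu.add_sub' hn (constructibleAt_const (t • o)) (constructibleAt_const o))
    h2).congr (Eventually.of_forall fun x => by module)

theorem sum (hn : 2 ≤ n) {A : Type*} {f : A → (ι → Rn n) → Rn n} (s : Finset A)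
    (hf : ∀ a, ConstructibleAt (f a) x₀) : ConstructibleAt (fun x => ∑ a ∈ s, f a x) x₀ := by
  classical
  induction s using Finset.induction_on with
  | empty => simpa using constructibleAt_const 0
  | insert a s ha ih =>
    simp only [Finset.sum_insert ha]
    exact (hf a).add hn ih

end ConstructibleAt

/-- The condition that two constructible functions have a given distance. -/
theorem linkGerm_dist (hn : 2 ≤ n) {f g : (ι → Rn n) → Rn n} (hf : ConstructibleAt f x₀)
    (hg : ConstructibleAt g x₀) {l : ℝ} (hl : 0 < l) :
    LinkGerm {x | dist (f x) (g x) = l} x₀ :=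
  LinkGerm.comp (J := Bool) (h := fun c => if c then g else f) hn
    ((isConfig_dist false true hl).linkGerm _) (by rintro (_ | _); exacts [hf, hg])

theorem linkGerm_eq (hn : 2 ≤ n) {f : (ι → Rn n) → Rn n} (hf : ConstructibleAt f x₀) (c : Rn n) :
    LinkGerm {x | f x = c} x₀ :=
  LinkGerm.comp (J := Unit) (h := fun _ => f) hn
    ((isConfig_pin () c).linkGerm _) fun _ => hf

end Linear

/-! ### Straight-line motion by inversion. -/

section Line

variable {n : ℕ} {ι : Type} [Fintype ι] {x₀ : ι → Rn n}

/-- The square roots of the two elbow positions cancel in the sum. -/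
theorem arm_add_arm (b : OrthonormalBasis (Fin n) ℝ (Rn n)) (i j : Fin n) (L l : ℝ) (x : Rn n) :
    arm b i j L l 1 x + arm b i j L l (-1) x =
      ((‖x‖ ^ 2 + L ^ 2 - l ^ 2) / (inner ℝ (b i) x ^ 2 + inner ℝ (b j) x ^ 2)) •
        ((inner ℝ (b i) x : ℝ) • b i + (inner ℝ (b j) x : ℝ) • b j) := by
  simp only [arm]
  rw [mul_comm (2 : ℝ), ← div_div]
  module

/-- An inversor draws a straight line. -/
theorem linkGerm_line_basis (hn : 2 ≤ n) (b : OrthonormalBasis (Fin n) ℝ (Rn n)) {i j : Fin n}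
    (hij : i ≠ j) :
    LinkGerm {x : Unit → Rn n | ∃ t : ℝ, x () = b i + t • b j} (fun _ => b i) := by
  have h22 : √(2 : ℝ) ^ 2 = 2 := Real.sq_sqrt zero_le_two
  have hreg : IsArmRegular b i j √2 1 (b i) := by
    rw [IsArmRegular, h22]
    simp [b.inner_eq_ite, hij.symm]
  have hP : ConstructibleAt (fun x : Unit → Rn n => x ()) (fun _ => b i) := constructibleAt_apply ()
  have hreg' : IsArmRegular b i j √2 1 (b i - 0) := by rwa [sub_zero]
  -- The two elbows and `P` form the Peaucellier rhombus. Since `√2 ^ 2 - 1 ^ 2 = 1`, the point `Q =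
  -- A + B - P` is `P / ‖P‖ ^ 2` for `P` in the plane.
  have hA := hP.arm b hij (L := √2) (by positivity) one_pos hreg' (Or.inl rfl)
  have hB := hP.arm b hij (L := √2) (by positivity) one_pos hreg' (Or.inr rfl)
  simp only [sub_zero, zero_add] at hA hB
  have hQ := (hA.add hn hB).sub hn hP
  -- The circle through the origin with centre `b i / 2` is the inverse of the line on which the `b
  -- i` coordinate is one.
  have h1 := linkGerm_dist hn hQ (constructibleAt_const ((2⁻¹ : ℝ) • b i)) (l := 2⁻¹) (by norm_num)
  -- `P - A` has norm one, so these distances make it orthogonal to the other `b k`; as `A` is in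
  -- the plane, so is `P`.
  have h2 := linkGerm_forall (A := {k // k ≠ i ∧ k ≠ j}) fun k =>
    linkGerm_dist hn (hP.sub hn hA) (constructibleAt_const (b k)) (l := √(1 ^ 2 + 1))
      (by positivity)
  refine (h1.inter h2).congr ?_
  have hc : ContinuousAt (fun x : Unit → Rn n => x ()) (fun _ => b i) :=
    (continuous_apply ()).continuousAt
  filter_upwards [hc.eventually (eventually_isArmRegular b hreg)] with x hx
  obtain ⟨a1, a2, a3⟩ := (arm_iff b hij (Real.sqrt_nonneg 2) zero_le_one hx _).2 (Or.inl rfl)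
  have e2 : x ∈ {x : Unit → Rn n | ∀ k : {k // k ≠ i ∧ k ≠ j},
      dist (x () - arm b i j √2 1 1 (x ())) (b k) = √(1 ^ 2 + 1)} ↔
      ∀ k, k ≠ i → k ≠ j → inner ℝ (b k) (x ()) = (0 : ℝ) := by
    simp only [mem_ofPred_eq, dist_eq_norm, norm_sub_basis_iff b a2, Subtype.forall, inner_sub_right]
    refine forall_congr' fun k => ?_
    constructor
    · intro h hi hj
      have := h ⟨hi, hj⟩
      rwa [a3 k hi hj, sub_zero] at this
    · rintro h ⟨hi, hj⟩
      rw [a3 k hi hj, sub_zero, h hi hj]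
  rw [mem_inter_iff, e2]
  have hρ := hx.1
  set X : ℝ := inner ℝ (b i) (x ()) with hX
  set Y : ℝ := inner ℝ (b j) (x ()) with hY
  have key : (∀ k, k ≠ i → k ≠ j → inner ℝ (b k) (x ()) = (0 : ℝ)) →
      (dist (arm b i j √2 1 1 (x ()) + arm b i j √2 1 (-1) (x ()) - x ()) ((2⁻¹ : ℝ) • b i) = 2⁻¹ ↔
        X = 1) := by
    intro h2
    have hpl := planar_eq b hij h2
    rw [← hX, ← hY] at hpl
    have hn2 : ‖x ()‖ ^ 2 = X ^ 2 + Y ^ 2 := by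
      rw [hpl, norm_sq_planar b hij]
    rw [arm_add_arm, ← hX, ← hY, hn2, h22, dist_eq_norm]
    have e3 : ((X ^ 2 + Y ^ 2 + 2 - 1 ^ 2) / (X ^ 2 + Y ^ 2)) • (X • b i + Y • b j) - x () -
        (2⁻¹ : ℝ) • b i = (X / (X ^ 2 + Y ^ 2) - 2⁻¹) • b i + (Y / (X ^ 2 + Y ^ 2)) • b j := by
      have : (X ^ 2 + Y ^ 2 + 2 - 1 ^ 2) / (X ^ 2 + Y ^ 2) = 1 + 1 / (X ^ 2 + Y ^ 2) := by
        field_simp; ring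
      rw [this, hpl, div_eq_mul_one_div X, div_eq_mul_one_div Y]
      module
    rw [e3, ← sq_eq_sq₀ (norm_nonneg _) (by norm_num), norm_sq_planar b hij]
    have e4 : (X / (X ^ 2 + Y ^ 2) - 2⁻¹) ^ 2 + (Y / (X ^ 2 + Y ^ 2)) ^ 2 - (2⁻¹) ^ 2 =
        (1 - X) / (X ^ 2 + Y ^ 2) := by
      field_simp; ring
    rw [← sub_eq_zero, e4, div_eq_zero_iff, or_iff_left hρ.ne', sub_eq_zero, eq_comm]
  constructor
  · rintro ⟨h1, h2⟩
    have hpl := planar_eq b hij h2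
    rw [← hX, ← hY, (key h2).1 h1, one_smul] at hpl
    exact ⟨Y, hpl⟩
  · rintro ⟨t, ht⟩
    have hx' : x () = (1 : ℝ) • b i + t • b j := by rw [ht, one_smul]
    have h2 : ∀ k, k ≠ i → k ≠ j → inner ℝ (b k) (x ()) = (0 : ℝ) := fun k hi hj => by
      rw [hx', inner_planar_of_ne b _ _ hi hj]
    refine ⟨(key h2).2 ?_, h2⟩
    rw [hX, ht, inner_add_right, inner_smul_right]
    simp [b.inner_eq_ite, hij]

/-- The condition that a constructible function moves on a given line. -/
theorem linkGerm_line (hn : 2 ≤ n) {f : (ι → Rn n) → Rn n} (hf : ConstructibleAt f x₀) {v : Rn n}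
    (hv : v ≠ 0) : LinkGerm {x | ∃ t : ℝ, f x = f x₀ + t • v} x₀ := by
  let i : Fin n := ⟨0, by lia⟩
  let j : Fin n := ⟨1, by lia⟩
  have hij : i ≠ j := by simp [i, j]
  have hv' := norm_ne_zero_iff.2 hv
  -- The normalized direction is completed to an orthonormal basis as `b j`; translating `f x₀` to
  -- `b i` reduces to the inversor's line.
  have ho : Orthonormal ℝ (({j} : Set (Fin n)).domRestrict fun _ => ‖v‖⁻¹ • v) := by
    constructor
    · intro k
      show ‖‖v‖⁻¹ • v‖ = 1
      rw [norm_smul, norm_inv, norm_norm, inv_mul_cancel₀ hv']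
    · intro k l hkl
      exact absurd (Subsingleton.elim k l) hkl
  obtain ⟨b, hb⟩ := ho.exists_orthonormalBasis_extension_of_card_eq (by simp)
  have hbj : b j = ‖v‖⁻¹ • v := hb j rfl
  have hg : ConstructibleAt (fun x => f x + (b i - f x₀)) x₀ := hf.add hn (constructibleAt_const _)
  have hL := linkGerm_line_basis hn b hij
  refine (LinkGerm.comp (J := Unit) (h := fun _ x => f x + (b i - f x₀)) hn
    (by simpa using hL) fun _ => hg).congr (Eventually.of_forall fun x => ?_)
  constructor
  · rintro ⟨t, ht⟩
    refine ⟨t * ‖v‖⁻¹, ?_⟩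
    have ht' : f x + (b i - f x₀) = b i + t • b j := ht
    rw [hbj, smul_smul] at ht'
    rw [← sub_eq_zero] at ht' ⊢
    rw [← ht']
    abel
  · rintro ⟨t, ht⟩
    refine ⟨t * ‖v‖, ?_⟩
    show f x + (b i - f x₀) = b i + (t * ‖v‖) • b j
    rw [hbj, smul_smul, mul_assoc, mul_inv_cancel₀ hv', mul_one, ht]
    abel

end Line

/-! ### Coordinates, and their transfer between axes. -/

section Scalar

variable {n : ℕ} {ι : Type} [Fintype ι] {x₀ : ι → Rn n}

/-- The standard unit vectors. -/
noncomputable abbrev unitVec (k : Fin n) : Rn n := EuclideanSpace.single k (1 : ℝ)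

theorem unitVec_ne_zero (k : Fin n) : unitVec k ≠ 0 := by
  intro h
  have := congrArg (fun v : Rn n => v k) h
  simp at this

theorem sum_smul_unitVec (v : Rn n) : ∑ k, v k • unitVec k = v := by
  ext m
  simp [Finset.sum_apply, Pi.single_apply]

/-- The components of a constructible function are constructible. -/
theorem ConstructibleAt.component (hn : 2 ≤ n) {f : (ι → Rn n) → Rn n} (hf : ConstructibleAt f x₀)
    (k : Fin n) : ConstructibleAt (fun x => f x k • unitVec k) x₀ := by
  have hβ : AnalyticAt ℝ (fun x (k : Fin n) => f x k • unitVec k) x₀ :=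
    AnalyticAt.pi fun k => AnalyticAt.smul
      (((EuclideanSpace.proj (𝕜 := ℝ) k).analyticAt _).comp hf.analyticAt) analyticAt_const
  set z₀ : Unit ⊕ Fin n → Rn n := Sum.elim (fun _ => f x₀) (fun k => f x₀ k • unitVec k) with hz₀
  have h1 := linkGerm_forall (A := Fin n) fun k =>
    linkGerm_line hn (constructibleAt_apply (x₀ := z₀) (Sum.inr k)) (unitVec_ne_zero k)
  have h2 := linkGerm_eq hn ((ConstructibleAt.sum hn Finset.univ fun k : Fin n =>
    constructibleAt_apply (x₀ := z₀) (Sum.inr k)).sub hn (constructibleAt_apply (Sum.inl ()))) 0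
  refine constructibleAt_implicit (J := Unit) (h := fun _ => f)
    (β := fun x (k : Fin n) => f x k • unitVec k) (fun _ => hf) hβ (h1.inter h2)
    (Eventually.of_forall fun p => ?_) k
  constructor
  · rintro ⟨e1, e2⟩
    have e1' : ∀ k, ∃ t : ℝ, p.2 k = f x₀ k • unitVec k + t • unitVec k := e1
    have e2' : ∑ k, p.2 k - f p.1 = 0 := e2
    choose t ht using e1'
    have ht' : ∀ k, p.2 k = (f x₀ k + t k) • unitVec k := fun k => by rw [ht, add_smul]
    funext m
    rw [ht' m]
    congr 1
    rw [← sub_eq_zero.1 e2']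
    simp [ht', Finset.sum_apply, Pi.single_apply]
  · intro h
    refine ⟨fun k => ⟨f p.1 k - f x₀ k, ?_⟩, ?_⟩
    · show p.2 k = f x₀ k • unitVec k + (f p.1 k - f x₀ k) • unitVec k
      rw [h]; module
    · show ∑ k, p.2 k - f p.1 = 0
      rw [h, sub_eq_zero, sum_smul_unitVec]

/-- A real valued function which is constructible as a multiple of every unit vector. -/
def ScalarConstructibleAt (s : (ι → Rn n) → ℝ) (x₀ : ι → Rn n) : Prop :=
  ∀ k : Fin n, ConstructibleAt (fun x => s x • unitVec k) x₀

theorem ConstructibleAt.analyticAt_coe {f : (ι → Rn n) → Rn n} (hf : ConstructibleAt f x₀)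
    (k : Fin n) : AnalyticAt ℝ (fun x => f x k) x₀ :=
  ((EuclideanSpace.proj (𝕜 := ℝ) k).analyticAt _).comp hf.analyticAt

/-- The point `s` on axis `m` is where that axis meets the line through the point `s` on axis `k`
with direction `unitVec m - unitVec k`. -/
theorem ConstructibleAt.scalar (hn : 2 ≤ n) {s : (ι → Rn n) → ℝ} {k : Fin n}
    (hs : ConstructibleAt (fun x => s x • unitVec k) x₀) : ScalarConstructibleAt s x₀ := by
  intro m
  rcases eq_or_ne k m with rfl | hkm
  · exact hs
  have hsa : AnalyticAt ℝ s x₀ := by simpa using hs.analyticAt_coe k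
  have hβ : AnalyticAt ℝ (fun x (_ : Unit) => s x • unitVec m) x₀ :=
    AnalyticAt.pi fun _ => hsa.smul analyticAt_const
  set z₀ : Unit ⊕ Unit → Rn n :=
    Sum.elim (fun _ => s x₀ • unitVec k) (fun _ => s x₀ • unitVec m) with hz₀
  have hne : unitVec m - unitVec k ≠ 0 := by
    intro h
    have := congrArg (fun v : Rn n => v k) h
    simp [hkm] at this
  have h1 := linkGerm_line hn (constructibleAt_apply (x₀ := z₀) (Sum.inr ())) (unitVec_ne_zero m)
  have h2 := linkGerm_line hn ((constructibleAt_apply (x₀ := z₀) (Sum.inr ())).sub hn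
    (constructibleAt_apply (Sum.inl ()))) hne
  refine constructibleAt_implicit (J := Unit) (K := Unit) (h := fun _ x => s x • unitVec k)
    (β := fun x _ => s x • unitVec m) (fun _ => hs) hβ (h1.inter h2)
    (Eventually.of_forall fun p => ?_) ()
  constructor
  · rintro ⟨⟨t, e1⟩, ⟨τ, e2⟩⟩
    have e1' : p.2 () = s x₀ • unitVec m + t • unitVec m := e1
    have e2' : p.2 () - s p.1 • unitVec k = s x₀ • unitVec m - s x₀ • unitVec k +
      τ • (unitVec m - unitVec k) := e2
    rw [e1'] at e2'
    have c1 := congrArg (fun v : Rn n => v k) e2'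
    have c2 := congrArg (fun v : Rn n => v m) e2'
    simp [hkm, hkm.symm] at c1 c2
    funext _
    rw [e1', ← add_smul]
    congr 1
    linarith
  · intro h
    refine ⟨⟨s p.1 - s x₀, ?_⟩, ⟨s p.1 - s x₀, ?_⟩⟩
    · show p.2 () = s x₀ • unitVec m + (s p.1 - s x₀) • unitVec m
      rw [h]; module
    · show p.2 () - s p.1 • unitVec k = s x₀ • unitVec m - s x₀ • unitVec k +
        (s p.1 - s x₀) • (unitVec m - unitVec k)
      rw [h]; module

theorem ConstructibleAt.scalar_component (hn : 2 ≤ n) {f : (ι → Rn n) → Rn n}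
    (hf : ConstructibleAt f x₀) (k : Fin n) : ScalarConstructibleAt (fun x => f x k) x₀ :=
  (hf.component hn k).scalar hn

end Scalar

/-! ### Arithmetic of constructible scalars. -/

section ScalarAlgebra

variable {n : ℕ} {ι : Type} [Fintype ι] {x₀ : ι → Rn n}

namespace ScalarConstructibleAt

variable {s t : (ι → Rn n) → ℝ}

theorem analyticAt (hn : 2 ≤ n) (hs : ScalarConstructibleAt s x₀) : AnalyticAt ℝ s x₀ := by
  simpa using (hs ⟨0, by lia⟩).analyticAt_coe ⟨0, by lia⟩

theorem congr (hs : ScalarConstructibleAt s x₀) (h : ∀ᶠ x in 𝓝 x₀, s x = t x) :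
    ScalarConstructibleAt t x₀ := fun k =>
  (hs k).congr (h.mono fun x hx => by rw [hx])

theorem const (c : ℝ) : ScalarConstructibleAt (fun _ => c) x₀ := fun _ => constructibleAt_const _

theorem add (hn : 2 ≤ n) (hs : ScalarConstructibleAt s x₀) (ht : ScalarConstructibleAt t x₀) :
    ScalarConstructibleAt (fun x => s x + t x) x₀ := fun k => by
  simpa only [add_smul] using (hs k).add hn (ht k)

theorem sub (hn : 2 ≤ n) (hs : ScalarConstructibleAt s x₀) (ht : ScalarConstructibleAt t x₀) :
    ScalarConstructibleAt (fun x => s x - t x) x₀ := fun k => by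
  simpa only [sub_smul] using (hs k).sub hn (ht k)

theorem const_mul (hn : 2 ≤ n) (hs : ScalarConstructibleAt s x₀) (c : ℝ) :
    ScalarConstructibleAt (fun x => c * s x) x₀ := fun k => by
  simpa only [mul_smul] using (hs k).const_smul hn c

/-- Pythagoras: a bar of length `K` is the hypotenuse of a right triangle with legs on two axes.
Near the base configuration the new leg stays positive, which selects the root. -/
theorem sqrt_sub_sq (hn : 2 ≤ n) (hs : ScalarConstructibleAt s x₀) {K : ℝ} (hK : 0 < K)
    (h : 0 < K ^ 2 - s x₀ ^ 2) : ScalarConstructibleAt (fun x => √(K ^ 2 - s x ^ 2)) x₀ := by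
  let i : Fin n := ⟨0, by lia⟩
  let j : Fin n := ⟨1, by lia⟩
  have hij : i ≠ j := by simp [i, j]
  have hsa := hs.analyticAt hn
  have hra : AnalyticAt ℝ (fun x => √(K ^ 2 - s x ^ 2)) x₀ :=
    AnalyticAt.sqrt_of_pos (by fun_prop) h
  have hβ : AnalyticAt ℝ (fun x (_ : Unit) => √(K ^ 2 - s x ^ 2) • unitVec j) x₀ :=
    AnalyticAt.pi fun _ => hra.smul analyticAt_const
  set z₀ : Unit ⊕ Unit → Rn n :=
    Sum.elim (fun _ => s x₀ • unitVec i) (fun _ => √(K ^ 2 - s x₀ ^ 2) • unitVec j) with hz₀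
  have h1 := linkGerm_line hn (constructibleAt_apply (x₀ := z₀) (Sum.inr ())) (unitVec_ne_zero j)
  have h2 := linkGerm_dist hn ((constructibleAt_apply (x₀ := z₀) (Sum.inr ())).add hn
    (constructibleAt_apply (Sum.inl ()))) (constructibleAt_const 0) hK
  have hnorm : ∀ a c : ℝ, ‖c • unitVec j + a • unitVec i‖ ^ 2 = c ^ 2 + a ^ 2 := by
    intro a c
    have := norm_sq_planar (EuclideanSpace.basisFun (Fin n) ℝ) hij.symm c a
    simpa only [EuclideanSpace.basisFun_apply] using this
  refine ConstructibleAt.scalar (k := j) hn (constructibleAt_implicit (J := Unit) (K := Unit)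
    (h := fun _ x => s x • unitVec i)
    (β := fun x _ => √(K ^ 2 - s x ^ 2) • unitVec j) (fun _ => hs i) hβ (h1.inter h2) ?_ ())
  have c1 : Tendsto (fun p : (ι → Rn n) × (Unit → Rn n) => p.1)
    (𝓝 (x₀, fun _ => √(K ^ 2 - s x₀ ^ 2) • unitVec j)) (𝓝 x₀) := continuousAt_fst
  have c2 : ContinuousAt (fun p : (ι → Rn n) × (Unit → Rn n) => p.2 () j)
      (x₀, fun _ => √(K ^ 2 - s x₀ ^ 2) • unitVec j) :=
    ((EuclideanSpace.proj (𝕜 := ℝ) j).continuous.comp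
      ((continuous_apply ()).comp continuous_snd)).continuousAt
  have c3 : ContinuousAt (fun x => K ^ 2 - s x ^ 2) x₀ :=
    continuousAt_const.sub (hsa.continuousAt.pow 2)
  have h0 : 0 < (√(K ^ 2 - s x₀ ^ 2) • unitVec j : Rn n) j := by
    simpa using h
  filter_upwards [c2.eventually_const_lt h0, c1.eventually (c3.eventually_const_lt h)] with p hp hp'
  constructor
  · rintro ⟨⟨t, e1⟩, e2⟩
    have e1' : p.2 () = √(K ^ 2 - s x₀ ^ 2) • unitVec j + t • unitVec j := e1
    have e2' : dist (p.2 () + s p.1 • unitVec i) 0 = K := e2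
    rw [← add_smul] at e1'
    rw [e1', dist_zero_right] at e2'
    have e3 := hnorm (s p.1) (√(K ^ 2 - s x₀ ^ 2) + t)
    rw [e2'] at e3
    rw [e1'] at hp
    have hp2 : 0 < √(K ^ 2 - s x₀ ^ 2) + t := by simpa using hp
    funext _
    have e4 : K ^ 2 - s p.1 ^ 2 = (√(K ^ 2 - s x₀ ^ 2) + t) ^ 2 := by linarith
    rw [e1', e4, Real.sqrt_sq hp2.le]
  · intro h
    refine ⟨⟨√(K ^ 2 - s p.1 ^ 2) - √(K ^ 2 - s x₀ ^ 2), ?_⟩, ?_⟩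
    · show p.2 () = √(K ^ 2 - s x₀ ^ 2) • unitVec j +
        (√(K ^ 2 - s p.1 ^ 2) - √(K ^ 2 - s x₀ ^ 2)) • unitVec j
      rw [h]; module
    · show dist (p.2 () + s p.1 • unitVec i) 0 = K
      rw [h, dist_zero_right, ← sq_eq_sq₀ (norm_nonneg _) hK.le, hnorm, Real.sq_sqrt hp'.le]
      ring

theorem sqrt_sq_add (hn : 2 ≤ n) (hs : ScalarConstructibleAt s x₀) {c : ℝ}
    (h : 0 < s x₀ ^ 2 + c) : ScalarConstructibleAt (fun x => √(s x ^ 2 + c)) x₀ := by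
  -- `s ^ 2 + c = (K ^ 2 + c) - (K ^ 2 - s ^ 2)`, so two right triangles suffice once `K` exceeds
  -- `|s x₀|`.
  set K : ℝ := |s x₀| + |c| + 1 with hK
  have hK0 : 0 < K := by positivity
  have hK1 : 0 < K ^ 2 - s x₀ ^ 2 := by
    rw [← sq_abs (s x₀), hK]
    nlinarith [abs_nonneg (s x₀), abs_nonneg c]
  have hK2 : 0 < K ^ 2 + c := by linarith
  have hw := hs.sqrt_sub_sq hn hK0 hK1
  have h2 : √(K ^ 2 + c) ^ 2 = K ^ 2 + c := Real.sq_sqrt hK2.le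
  have h3 : 0 < √(K ^ 2 + c) ^ 2 - √(K ^ 2 - s x₀ ^ 2) ^ 2 := by
    rw [h2, Real.sq_sqrt hK1.le]; linarith
  refine (hw.sqrt_sub_sq hn (by positivity) h3).congr ?_
  have c3 : ContinuousAt (fun x => K ^ 2 - s x ^ 2) x₀ :=
    continuousAt_const.sub ((hs.analyticAt hn).continuousAt.pow 2)
  filter_upwards [c3.eventually_const_lt hK1] with x hx
  rw [h2, Real.sq_sqrt hx.le]
  congr 1
  ring

/-- Since `(√(r ^ 2 + 1) - r) * (√(r ^ 2 + 1) + r) = 1`, solving `√(r ^ 2 + 1) - r = s` for `r`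
gives `s⁻¹ = 2 * r + s`. The solution `r` is constructed implicitly. -/
theorem inv_of_pos (hn : 2 ≤ n) (hs : ScalarConstructibleAt s x₀) (h : 0 < s x₀) :
    ScalarConstructibleAt (fun x => (s x)⁻¹) x₀ := by
  let i : Fin n := ⟨0, by lia⟩
  have hsa := hs.analyticAt hn
  set r : (ι → Rn n) → ℝ := fun x => (1 - s x ^ 2) / (2 * s x) with hr
  have hra : AnalyticAt ℝ r x₀ := by
    refine AnalyticAt.div (by fun_prop) (by fun_prop) (by positivity)
  have hβ : AnalyticAt ℝ (fun x (_ : Unit) => r x • unitVec i) x₀ :=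
    AnalyticAt.pi fun _ => hra.smul analyticAt_const
  set z₀ : Unit ⊕ Unit → Rn n :=
    Sum.elim (fun _ => s x₀ • unitVec i) (fun _ => r x₀ • unitVec i) with hz₀
  have hy := constructibleAt_apply (x₀ := z₀) (Sum.inr ())
  have hyi := hy.scalar_component hn i
  have h1 := linkGerm_line hn hy (unitVec_ne_zero i)
  have h2 := linkGerm_eq hn ((((hyi.sqrt_sq_add hn (c := 1) (by positivity)).sub hn hyi) i).sub hn
    (constructibleAt_apply (Sum.inl ()))) 0
  have key : ConstructibleAt (fun x => r x • unitVec i) x₀ := by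
    refine constructibleAt_implicit (J := Unit) (K := Unit) (h := fun _ x => s x • unitVec i)
      (β := fun x _ => r x • unitVec i) (fun _ => hs i) hβ (h1.inter h2) ?_ ()
    have c1 : Tendsto (fun p : (ι → Rn n) × (Unit → Rn n) => p.1)
      (𝓝 (x₀, fun _ => r x₀ • unitVec i)) (𝓝 x₀) := continuousAt_fst
    filter_upwards [c1.eventually (hsa.continuousAt.eventually_const_lt h)] with p hp
    constructor
    · rintro ⟨⟨t, e1⟩, e2⟩
      have e1' : p.2 () = r x₀ • unitVec i + t • unitVec i := e1
      have e2' : (√(p.2 () i ^ 2 + 1) - p.2 () i) • unitVec i - s p.1 • unitVec i = 0 := e2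
      rw [← add_smul] at e1'
      set σ := r x₀ + t
      have e3 : p.2 () i = σ := by simp [e1']
      rw [e3] at e2'
      have e4 : √(σ ^ 2 + 1) - σ = s p.1 := by
        simpa [sub_eq_zero] using congrArg (fun v : Rn n => v i) e2'
      have e5 : (s p.1 + σ) ^ 2 = σ ^ 2 + 1 := by
        rw [← e4, sub_add_cancel, Real.sq_sqrt (by positivity)]
      funext _
      rw [e1', hr]
      congr 1
      field_simp
      linarith
    · intro h
      have e0 : p.2 () = r p.1 • unitVec i := by rw [h]
      refine ⟨⟨r p.1 - r x₀, ?_⟩, ?_⟩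
      · show p.2 () = r x₀ • unitVec i + (r p.1 - r x₀) • unitVec i
        rw [e0]; module
      · show (√(p.2 () i ^ 2 + 1) - p.2 () i) • unitVec i - s p.1 • unitVec i = 0
        have e1 : p.2 () i = r p.1 := by simp [e0]
        have e2 : √(r p.1 ^ 2 + 1) = r p.1 + s p.1 := by
          have e3 : r p.1 + s p.1 = (1 + s p.1 ^ 2) / (2 * s p.1) := by
            rw [hr]; field_simp; ring
          rw [Real.sqrt_eq_iff_eq_sq (by positivity) (by rw [e3]; positivity), hr]
          field_simp
          ring
        rw [e1, e2, add_sub_cancel_left, sub_self]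
  refine (((key.scalar hn).const_mul hn 2).add hn hs).congr ?_
  filter_upwards [hsa.continuousAt.eventually_const_lt h] with x hx
  rw [hr]
  field_simp
  ring

/-- `(c - s)⁻¹ + (c + s)⁻¹ = 2 * c / (c ^ 2 - s ^ 2)`, so reciprocals and sums give squares; `c > |s
x₀|` keeps all denominators positive. -/
theorem sq (hn : 2 ≤ n) (hs : ScalarConstructibleAt s x₀) :
    ScalarConstructibleAt (fun x => s x ^ 2) x₀ := by
  set c : ℝ := |s x₀| + 1 with hc
  have hc0 : 0 < c := by positivity
  have h1 : 0 < c - s x₀ := by linarith [le_abs_self (s x₀)]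
  have h2 : 0 < c + s x₀ := by linarith [neg_abs_le (s x₀)]
  have hu := ((const c).sub hn hs).inv_of_pos hn h1
  have hv := ((const c).add hn hs).inv_of_pos hn h2
  have hw := (hu.add hn hv).inv_of_pos hn (by positivity)
  refine ((const (c ^ 2)).sub hn (hw.const_mul hn (2 * c))).congr ?_
  have hsc := (hs.analyticAt hn).continuousAt
  filter_upwards [(continuousAt_const.sub hsc).eventually_const_lt h1,
    (continuousAt_const.add hsc).eventually_const_lt h2] with x hx hx'
  change 0 < c - s x at hx
  change 0 < c + s x at hx'
  have e : (c - s x)⁻¹ + (c + s x)⁻¹ = 2 * c / ((c - s x) * (c + s x)) := by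
    field_simp; ring
  rw [e, inv_div, mul_div_cancel₀ _ (by positivity)]
  ring

theorem mul (hn : 2 ≤ n) (hs : ScalarConstructibleAt s x₀) (ht : ScalarConstructibleAt t x₀) :
    ScalarConstructibleAt (fun x => s x * t x) x₀ := by
  refine ((((hs.add hn ht).sq hn).sub hn ((hs.sub hn ht).sq hn)).const_mul hn (1 / 4)).congr
    (Eventually.of_forall fun x => ?_)
  ring

theorem pow (hn : 2 ≤ n) (hs : ScalarConstructibleAt s x₀) (d : ℕ) :
    ScalarConstructibleAt (fun x => s x ^ d) x₀ := by
  induction d with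
  | zero => simpa using const 1
  | succ d ih => simpa only [pow_succ] using ih.mul hn hs

theorem linkGerm_eq_zero (hn : 2 ≤ n) (hs : ScalarConstructibleAt s x₀) :
    LinkGerm {x | s x = 0} x₀ := by
  refine (linkGerm_eq hn (hs ⟨0, by lia⟩) 0).congr (Eventually.of_forall fun x => ?_)
  show s x • unitVec _ = 0 ↔ s x = 0
  rw [smul_eq_zero, or_iff_left (unitVec_ne_zero _)]

end ScalarConstructibleAt

/-- Linear functionals are constructible. -/
theorem scalarConstructibleAt_dual (hn : 2 ≤ n) {κ : Type} [Fintype κ] (σ : κ → ι)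
    (φ : Module.Dual ℝ (κ → Rn n)) : ScalarConstructibleAt (fun x => φ (x ∘ σ)) x₀ := by
  classical
  have h : ∀ x : κ → Rn n, φ x = ∑ k, ∑ i, φ (Pi.single k (unitVec i)) * x k i := by
    intro x
    have hx : x = ∑ k, ∑ i, x k i • (Pi.single k (unitVec i) : κ → Rn n) := by
      funext m
      rw [Finset.sum_apply, Finset.sum_eq_single m]
      · simp only [Finset.sum_apply, Pi.smul_apply, Pi.single_eq_same, sum_smul_unitVec]
      · intro k _ hk
        simp [Finset.sum_apply, hk.symm]
      · simp
    conv_lhs => rw [hx]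
    simp only [map_sum, map_smul, smul_eq_mul, mul_comm]
  have sum : ∀ {A : Type} (s : Finset A) {f : A → (ι → Rn n) → ℝ},
      (∀ a, ScalarConstructibleAt (f a) x₀) →
      ScalarConstructibleAt (fun x => ∑ a ∈ s, f a x) x₀ := by
    intro A s f hf k
    simp only [Finset.sum_smul]
    exact ConstructibleAt.sum hn s fun a => hf a k
  have h' : (fun x : ι → Rn n => φ (x ∘ σ)) = fun x => ∑ k, ∑ i,
      φ (Pi.single k (unitVec i)) * x (σ k) i := funext fun x => h _
  rw [h']
  exact sum _ fun k => sum _ fun i =>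
    ((constructibleAt_apply (σ k)).scalar_component hn i).const_mul hn _

/-- Homogenized polynomials are constructible: some multiple of `p (x / ε)` by a power of `ε` is. -/
theorem IsPolynomialFunction.exists_homogenization (hn : 2 ≤ n) {κ : Type} [Fintype κ]
    {p : (κ → Rn n) → ℝ} (hp : IsPolynomialFunction p) (σ : κ → ι) {ε : (ι → Rn n) → ℝ}
    (hε : ScalarConstructibleAt ε x₀) :
    ∃ (d : ℕ) (P : (ι → Rn n) → ℝ), ScalarConstructibleAt P x₀ ∧
      ∀ x, ε x ≠ 0 → P x = ε x ^ d * p ((ε x)⁻¹ • (x ∘ σ)) := by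
  induction hp using Algebra.adjoin_induction with
  | mem p hp =>
    obtain ⟨φ, rfl⟩ := hp
    refine ⟨1, _, scalarConstructibleAt_dual hn σ φ, fun x hx => ?_⟩
    simp only [map_smul, smul_eq_mul, pow_one]
    field_simp
  | algebraMap r => exact ⟨0, _, ScalarConstructibleAt.const r, fun x hx => by simp⟩
  | add p q _ _ hp hq =>
    obtain ⟨d, P, hP, h⟩ := hp
    obtain ⟨d', Q, hQ, h'⟩ := hq
    refine ⟨d + d', _, ((hε.pow hn d').mul hn hP).add hn ((hε.pow hn d).mul hn hQ), fun x hx => ?_⟩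
    rw [h x hx, h' x hx, Pi.add_apply]
    ring
  | mul p q _ _ hp hq =>
    obtain ⟨d, P, hP, h⟩ := hp
    obtain ⟨d', Q, hQ, h'⟩ := hq
    refine ⟨d + d', _, hP.mul hn hQ, fun x hx => ?_⟩
    rw [h x hx, h' x hx, Pi.mul_apply]
    ring

end ScalarAlgebra

/-! ### Real algebraic sets and linear maps. -/

section Polynomial

variable {E E' : Type*} [NormedAddCommGroup E] [NormedSpace ℝ E] [NormedAddCommGroup E']
  [NormedSpace ℝ E']

theorem isPolynomialFunction_dual (φ : Module.Dual ℝ E) : IsPolynomialFunction fun x => φ x :=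
  Algebra.subset_adjoin ⟨φ, rfl⟩

theorem isPolynomialFunction_const (c : ℝ) : IsPolynomialFunction fun _ : E => c :=
  Subalgebra.algebraMap_mem _ c

theorem IsPolynomialFunction.comp_linear {p : E' → ℝ} (hp : IsPolynomialFunction p)
    (A : E →ₗ[ℝ] E') : IsPolynomialFunction fun x => p (A x) := by
  induction hp using Algebra.adjoin_induction with
  | mem p hp =>
    obtain ⟨φ, rfl⟩ := hp
    exact isPolynomialFunction_dual (φ ∘ₗ A)
  | algebraMap r => exact isPolynomialFunction_const r
  | add p q _ _ hp hq => exact Subalgebra.add_mem _ hp hq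
  | mul p q _ _ hp hq => exact Subalgebra.mul_mem _ hp hq

theorem IsRealAlgebraicSet.preimage_linear {X : Set E'} (hX : IsRealAlgebraicSet X)
    (A : E →ₗ[ℝ] E') : IsRealAlgebraicSet (A ⁻¹' X) := by
  obtain ⟨S, hS, rfl⟩ := hX
  refine ⟨(fun p x => p (A x)) '' S, ?_, ?_⟩
  · rintro _ ⟨p, hp, rfl⟩
    exact (hS p hp).comp_linear A
  · ext x
    simp

theorem IsRealAlgebraicSet.inter {X Y : Set E} (hX : IsRealAlgebraicSet X)
    (hY : IsRealAlgebraicSet Y) : IsRealAlgebraicSet (X ∩ Y) := by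
  obtain ⟨S, hS, rfl⟩ := hX
  obtain ⟨T, hT, rfl⟩ := hY
  refine ⟨S ∪ T, fun p hp => hp.elim (hS p) (hT p), ?_⟩
  ext x
  simp [or_imp, forall_and]

theorem isRealAlgebraicSet_linear_eq (A B : E →ₗ[ℝ] E') :
    IsRealAlgebraicSet {x | A x = B x} := by
  refine ⟨range fun (φ : Module.Dual ℝ E') (x : E) => (φ ∘ₗ (A - B)) x, ?_, ?_⟩
  · rintro _ ⟨φ, rfl⟩
    exact isPolynomialFunction_dual _
  · ext x
    simp only [forall_mem_range, mem_ofPred_eq, LinearMap.comp_apply, LinearMap.sub_apply]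
    rw [Module.forall_dual_apply_eq_zero_iff, sub_eq_zero]

/-- A real algebraic set is the set of zeros of a single polynomial. -/
theorem IsRealAlgebraicSet.exists_eq [FiniteDimensional ℝ E] {X : Set E}
    (hX : IsRealAlgebraicSet X) :
    ∃ p : E → ℝ, IsPolynomialFunction p ∧ ∀ x, x ∈ X ↔ p x = 0 := by
  classical
  obtain ⟨S, hS, rfl⟩ := hX
  set A := Algebra.adjoin ℝ (range fun (φ : Module.Dual ℝ E) (x : E) => φ x) with hA
  have hfg : A.FG := by
    let B := Module.finBasis ℝ (Module.Dual ℝ E)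
    refine ⟨Finset.univ.image fun i => (fun x : E => B i x), le_antisymm ?_ ?_⟩
    · refine Algebra.adjoin_mono ?_
      simp only [Finset.coe_image, Finset.coe_univ, image_univ]
      rintro _ ⟨i, rfl⟩
      exact ⟨B i, rfl⟩
    · refine Algebra.adjoin_le ?_
      rintro _ ⟨φ, rfl⟩
      have : (fun x : E => φ x) = ∑ i, B.repr φ i • (fun x : E => B i x) := by
        funext x
        have := congrArg (fun ψ : Module.Dual ℝ E => ψ x) (B.sum_repr φ)
        simp only [LinearMap.sum_apply, LinearMap.smul_apply] at this
        simp only [Finset.sum_apply, Pi.smul_apply]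
        exact this.symm
      show (fun x : E => φ x) ∈ _
      rw [this]
      refine Subalgebra.sum_mem _ fun i _ => Subalgebra.smul_mem _ (Algebra.subset_adjoin ?_) _
      simp
  -- By Hilbert's basis theorem finitely many of the equations generate the ideal of all; their sum
  -- of squares is a single equation.
  have hN : IsNoetherianRing A := isNoetherianRing_of_fg hfg
  obtain ⟨T, hT, hspan⟩ := (Submodule.fg_span_iff_fg_span_finset_subset (R := A)
    {p : A | (p : E → ℝ) ∈ S}).1 (IsNoetherian.noetherian _)
  refine ⟨fun x => ∑ p ∈ T, (p : E → ℝ) x ^ 2, ?_, fun x => ?_⟩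
  · have : (fun x => ∑ p ∈ T, (p : E → ℝ) x ^ 2) = ((∑ p ∈ T, p ^ 2 : A) : E → ℝ) := by
      funext x
      simp [Finset.sum_apply]
    rw [this]
    exact (∑ p ∈ T, p ^ 2 : A).2
  · rw [Finset.sum_eq_zero_iff_of_nonneg fun _ _ => sq_nonneg _]
    constructor
    · intro h p hp
      rw [h _ (hT hp)]
      simp
    · intro h p hp
      let ev : A →+* ℝ := (Pi.evalRingHom (fun _ : E => ℝ) x).comp A.val.toRingHom
      have h1 : Ideal.span (T : Set A) ≤ RingHom.ker ev := by
        rw [Ideal.span_le]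
        intro q hq
        have := h q hq
        exact pow_eq_zero_iff two_ne_zero |>.1 this
      have h2 : (⟨p, hS p hp⟩ : A) ∈ Ideal.span (T : Set A) := by
        have : (⟨p, hS p hp⟩ : A) ∈ Submodule.span A {p : A | (p : E → ℝ) ∈ S} :=
          Submodule.subset_span hp
        rw [hspan] at this
        exact this
      exact h1 h2

end Polynomial

/-! ### Analytic isomorphisms, and labels of finitely many points. -/

section AnalyticIso

variable {E E' E'' : Type*} [NormedAddCommGroup E] [NormedSpace ℝ E]
  [NormedAddCommGroup E'] [NormedSpace ℝ E'] [NormedAddCommGroup E''] [NormedSpace ℝ E'']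

theorem isAnalyticOnSet_of_analyticAt {f : E → E'} {X : Set E} (h : ∀ x ∈ X, AnalyticAt ℝ f x) :
    IsAnalyticOnSet f X := ⟨f, h, fun _ _ => rfl⟩

theorem IsAnalyticOnSet.comp {f : E → E'} {g : E' → E''} {X : Set E} {Y : Set E'}
    (hg : IsAnalyticOnSet g Y) (hf : IsAnalyticOnSet f X) (h : MapsTo f X Y) :
    IsAnalyticOnSet (fun x => g (f x)) X := by
  obtain ⟨F, hF, hfF⟩ := hf
  obtain ⟨G, hG, hgG⟩ := hg
  refine ⟨G ∘ F, fun x hx => ?_, fun x hx => ?_⟩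
  · refine AnalyticAt.comp (hG _ ?_) (hF x hx)
    rw [← hfF hx]
    exact h hx
  · rw [Function.comp_apply, ← hfF hx]
    exact hgG (h hx)

theorem AreAnalyticallyIsomorphic.symm {X : Set E} {Y : Set E'}
    (h : AreAnalyticallyIsomorphic X Y) : AreAnalyticallyIsomorphic Y X := by
  obtain ⟨f, h1, h2, g, h3, h4, h5⟩ := h
  exact ⟨g, h3, h4, f, h1, h2, h5.symm⟩

theorem AreAnalyticallyIsomorphic.trans {X : Set E} {Y : Set E'} {Z : Set E''}
    (h : AreAnalyticallyIsomorphic X Y) (h' : AreAnalyticallyIsomorphic Y Z) :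
    AreAnalyticallyIsomorphic X Z := by
  obtain ⟨f, h1, h2, g, h3, h4, h5⟩ := h
  obtain ⟨f', h1', h2', g', h3', h4', h5'⟩ := h'
  exact ⟨_, h1'.comp h1 h2, h2'.comp h2, _, h3.comp h3' h4', h4.comp h4', h5.comp h5' h2 h4'⟩

theorem areAnalyticallyIsomorphic_of_maps {X : Set E} {Y : Set E'} {f : E → E'} {g : E' → E}
    (hf : ∀ x, AnalyticAt ℝ f x) (hg : ∀ y, AnalyticAt ℝ g y) (hfm : MapsTo f X Y)
    (hgm : MapsTo g Y X) (h : InvOn g f X Y) : AreAnalyticallyIsomorphic X Y :=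
  ⟨f, isAnalyticOnSet_of_analyticAt fun x _ => hf x, hfm, g,
    isAnalyticOnSet_of_analyticAt fun x _ => hg x, hgm, h⟩

end AnalyticIso

/-- Finitely many distinct points can be told apart by a locally constant function. -/
theorem exists_eventually_index_eq {N Y : Type*} [Finite N] [Nonempty N] [TopologicalSpace Y]
    [T2Space Y] {c : N → Y} (hc : Function.Injective c) :
    ∃ idx : Y → N, ∀ j, ∀ᶠ y in 𝓝 (c j), idx y = j := by
  classical
  obtain ⟨U, hU, hd⟩ := (finite_range c).t2_separation
  refine ⟨fun y => if h : ∃ j, y ∈ U (c j) then h.choose else Classical.arbitrary N, fun j => ?_⟩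
  filter_upwards [(hU (c j)).2.mem_nhds (hU (c j)).1] with y hy
  have h : ∃ j, y ∈ U (c j) := ⟨j, hy⟩
  rw [dif_pos h]
  by_contra hne
  exact disjoint_left.1 (hd (mem_range_self _) (mem_range_self _) fun e => hne (hc e))
    h.choose_spec hy

/-! ### From germs at the origin to compact algebraic sets. -/

section Universality

variable {n : ℕ}

/-- Scaled so that one more vertex lies at a unit vector, compact real algebraic sets are cut out by
linkages with finitely many analytic solutions for the additional vertices. -/
theorem exists_config_cover (hn : 2 ≤ n) {κ : Type} [Fintype κ] {X : Set (κ → Rn n)}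
    (hX : IsRealAlgebraicSet X) (hXc : IsCompact X) :
    ∃ (ν : Type) (_ : Fintype ν) (N : Type) (_ : Fintype N) (_ : Nonempty N)
      (T : Set (κ ⊕ ν → Rn n)) (α : N → (κ → Rn n) → ν → Rn n) (idx : (ν → Rn n) → N),
      IsConfig T ∧ (∀ φ, φ ∈ T ↔ φ ∘ Sum.inl ∈ X ∧ ∃ f, φ ∘ Sum.inr = α f (φ ∘ Sum.inl)) ∧
      ∀ x ∈ X, ∀ f, AnalyticAt ℝ (α f) x ∧ ∀ᶠ y in 𝓝 (α f x), idx y = f := by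
  obtain ⟨p, hp, hXp⟩ := hX.exists_eq
  let i₀ : Fin n := ⟨0, by lia⟩
  -- Every sufficiently small multiple of `X`, together with its scale stored in the extra vertex,
  -- lies near this base configuration.
  let x₀ : κ ⊕ Unit → Rn n := 0
  have hε : ScalarConstructibleAt (fun x : κ ⊕ Unit → Rn n => x (.inr ()) i₀) x₀ :=
    (constructibleAt_apply (Sum.inr ())).scalar_component hn i₀
  obtain ⟨d, P, hP, hPp⟩ := hp.exists_homogenization hn Sum.inl hε
  -- After localization even configurations far from the base satisfy `P = 0`. Once the scale is
  -- pinned this forces membership in `X`, and so puts them back into the ball where the branches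
  -- are known.
  obtain ⟨ν, _, N, _, _, S, α, h1, h2, h3, h4, h5⟩ :=
    (hP.linkGerm_eq_zero hn).localize hn univ_mem
  obtain ⟨idx, hidx⟩ := exists_eventually_index_eq h4
  have h6 : ∀ᶠ x in 𝓝 x₀, ∀ f, AnalyticAt ℝ (α f) x ∧ ∀ᶠ y in 𝓝 (α f x), idx y = f := by
    rw [eventually_all]
    exact fun f => (h3 f).eventually_analyticAt.and
      ((h3 f).continuousAt.eventually (eventually_eventually_nhds.2 (hidx f)))
  obtain ⟨δ, hδ, hball⟩ := Metric.eventually_nhds_iff_ball.1 (h5.and h6)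
  obtain ⟨M, hM⟩ := hXc.isBounded.exists_norm_le
  -- Small enough that `ε` times any point of `X`, or the unit vector recording the scale, lies
  -- within `δ` of the origin.
  set ε : ℝ := δ / (2 * (|M| + 1)) with hεdef
  have hε0 : 0 < ε := by positivity
  have hεM : ε * (|M| + 1) < δ := by
    rw [hεdef]; field_simp; linarith
  let emb : (κ → Rn n) → κ ⊕ Unit → Rn n := fun x => ε • Sum.elim x fun _ => unitVec i₀
  have hemb : ∀ x ∈ X, emb x ∈ Metric.ball x₀ δ := by
    intro x hx
    rw [mem_ball_zero_iff]
    refine lt_of_le_of_lt ?_ hεM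
    rw [norm_smul, Real.norm_of_nonneg hε0.le]
    gcongr
    rw [pi_norm_le_iff_of_nonneg (by positivity)]
    rintro (k | k)
    · have := (norm_le_pi_norm x k).trans (hM x hx)
      simp only [Sum.elim_inl]
      linarith [le_abs_self M]
    · simp
  have hembA : ∀ x, AnalyticAt ℝ emb x := fun x => by
    have : AnalyticAt ℝ (fun x : κ → Rn n => (Sum.elim x fun _ => unitVec i₀ : κ ⊕ Unit → Rn n)) x :=
      AnalyticAt.sumElim (f := fun x : κ → Rn n => x) (g := fun _ _ => unitVec i₀)
        analyticAt_id analyticAt_const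
    exact (analyticAt_const (v := ε)).smul this
  have hεemb : ∀ x, emb x (.inr ()) i₀ = ε := fun x => by simp [emb]
  have hPX : ∀ x, P (emb x) = 0 ↔ x ∈ X := by
    intro x
    rw [hPp _ (by rw [hεemb]; exact hε0.ne'), hεemb, hXp]
    have : ε⁻¹ • (emb x ∘ Sum.inl) = x := by
      ext1 k
      simp [emb, smul_smul, hε0.ne']
    rw [this, mul_eq_zero, or_iff_right (pow_ne_zero _ hε0.ne')]
  let τ : (κ ⊕ Unit) ⊕ ν → κ ⊕ (Unit ⊕ ν) :=
    Sum.elim (Sum.map id Sum.inl) (Sum.inr ∘ Sum.inr)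
  refine ⟨Unit ⊕ ν, inferInstance, N, inferInstance, inferInstance,
    {φ | ε • (φ ∘ τ) ∈ S} ∩ {φ | φ (.inr (.inl ())) = unitVec i₀},
    fun f x => Sum.elim (fun _ => unitVec i₀) (ε⁻¹ • α f (emb x)),
    fun y => idx (ε • (y ∘ Sum.inr)), ?_, ?_, ?_⟩
  · exact ((h1.smul hε0).comap τ).inter (isConfig_pin _ _)
  · intro φ
    have hφ : φ (.inr (.inl ())) = unitVec i₀ →
        ε • (φ ∘ τ) = Sum.elim (emb (φ ∘ Sum.inl)) (ε • (φ ∘ Sum.inr ∘ Sum.inr)) := by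
      intro h
      ext1 ((k | k) | k)
      · rfl
      · simp [emb, τ, h]
      · rfl
    constructor
    · rintro ⟨hS, he⟩
      have hS' : ε • (φ ∘ τ) ∈ S := hS
      rw [hφ he] at hS'
      have hx : φ ∘ Sum.inl ∈ X := (hPX _).1 (h2 _ hS').1
      obtain ⟨-, f, hf⟩ := ((hball _ (hemb _ hx)).1 _).1 hS'
      refine ⟨hx, f, ?_⟩
      ext1 (k | k)
      · exact he
      · simp only [Sum.elim_inr, ← hf, smul_smul, inv_mul_cancel₀ hε0.ne', one_smul]
        rfl
    · rintro ⟨hx, f, hf⟩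
      have he : φ (.inr (.inl ())) = unitVec i₀ := congrFun hf (.inl ())
      refine ⟨?_, he⟩
      show ε • (φ ∘ τ) ∈ S
      rw [hφ he]
      refine ((hball _ (hemb _ hx)).1 _).2 ⟨(hPX _).2 hx, f, ?_⟩
      have : φ ∘ Sum.inr ∘ Sum.inr = ε⁻¹ • α f (emb (φ ∘ Sum.inl)) :=
        funext fun k => congrFun hf (.inr k)
      rw [this, smul_smul, mul_inv_cancel₀ hε0.ne', one_smul]
  · intro x hx f
    obtain ⟨ha, hi⟩ := (hball _ (hemb x hx)).2 f
    constructor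
    · have h7 := ha.comp_of_eq (hembA x) rfl
      exact analyticAt_const.sumElim ((analyticAt_const (v := ε⁻¹)).smul h7)
    · have hc : ContinuousAt (fun y : Unit ⊕ ν → Rn n => ε • (y ∘ Sum.inr))
          (Sum.elim (fun _ => unitVec i₀) (ε⁻¹ • α f (emb x))) :=
        ((analyticAt_comp_index _ _).continuousAt).const_smul ε
      have hi' : ∀ᶠ w in 𝓝 (ε • ((Sum.elim (fun _ => unitVec i₀) (ε⁻¹ • α f (emb x)) :
          Unit ⊕ ν → Rn n) ∘ Sum.inr)), idx w = f := by
        simpa [smul_smul, hε0.ne'] using hi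
      exact hc.eventually hi'

/-- The universality theorem for sets of configurations. -/
theorem exists_config_iso (hn : 2 ≤ n) {a : ℕ} {X : Set (Fin a → Rn n)} (k : ℕ)
    (hX : IsRealAlgebraicSet X) (hXc : IsCompact X) :
    ∃ (m : ℕ) (S : Set (Fin a ⊕ Fin m → Rn n)) (F : Set ℝ)
      (α : (Fin a → Rn n) × ℝ × (Fin k → Rn n) → (Fin m → Rn n)),
      IsConfig S ∧ F.Finite ∧ F.Nonempty ∧ IsAnalyticOnSet α (X ×ˢ F ×ˢ univ) ∧
      S = {φ | ∃ x ∈ X, ∃ f ∈ F, ∃ y, φ = Sum.elim x (α (x, f, y))} ∧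
      IsAnalyticIso (fun z : (Fin a → Rn n) × ℝ × (Fin k → Rn n) => Sum.elim z.1 (α z))
        (X ×ˢ F ×ˢ univ) S := by
  obtain ⟨ν, _, N, _, _, T, α, idx, h1, h2, h3⟩ := exists_config_cover hn hX hXc
  let e : Fin (Fintype.card (ν ⊕ Fin k)) ≃ ν ⊕ Fin k := (Fintype.equivFin _).symm
  -- The branches are labelled by distinct reals, whose range is `F`. As `idxR` is locally constant
  -- near them, `A` is analytic in the label.
  let c : N → ℝ := fun j => (Fintype.equivFin N j : ℕ)
  have hc : Function.Injective c := fun i j h => by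
    simpa [c, Fin.val_inj] using h
  obtain ⟨idxR, hR⟩ := exists_eventually_index_eq hc
  have hR' : ∀ j, idxR (c j) = j := fun j => (hR j).self_of_nhds
  let A : (Fin a → Rn n) × ℝ × (Fin k → Rn n) → (Fin (Fintype.card (ν ⊕ Fin k)) → Rn n) :=
    fun z => Sum.elim (α (idxR z.2.1) z.1) z.2.2 ∘ e
  -- Nothing constrains the vertices indexed by `Fin k`; their positions are the coordinates `y`.
  let S : Set (Fin a ⊕ Fin (Fintype.card (ν ⊕ Fin k)) → Rn n) :=
    {φ | φ ∘ Sum.map id (e.symm ∘ Sum.inl) ∈ T}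
  have hS : ∀ φ, φ ∈ S ↔ φ ∘ Sum.inl ∈ X ∧
      ∃ f, φ ∘ Sum.inr ∘ e.symm ∘ Sum.inl = α f (φ ∘ Sum.inl) := fun φ => h2 _
  have hAa : ∀ z ∈ X ×ˢ range c ×ˢ (univ : Set (Fin k → Rn n)), AnalyticAt ℝ A z := by
    rintro ⟨x, _, y⟩ ⟨hx, ⟨j, rfl⟩, -⟩
    have q1 : AnalyticAt ℝ (fun z : (Fin a → Rn n) × ℝ × (Fin k → Rn n) => α j z.1) (x, c j, y) :=
      (h3 x hx j).1.comp_of_eq analyticAt_fst rfl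
    have q2 : AnalyticAt ℝ (fun z : (Fin a → Rn n) × ℝ × (Fin k → Rn n) => z.2.2) (x, c j, y) :=
      analyticAt_snd.comp_of_eq analyticAt_snd rfl
    have q3 := (analyticAt_comp_index e (Sum.elim (α j x) y)).comp_of_eq (q1.sumElim q2) rfl
    have q4 : ContinuousAt (fun z : (Fin a → Rn n) × ℝ × (Fin k → Rn n) => z.2.1) (x, c j, y) :=
      (continuous_fst.comp continuous_snd).continuousAt
    refine q3.congr ?_
    filter_upwards [q4.eventually (hR j)] with z hz
    simp only [A, hz]
    rfl
  have hSeq : S = {φ | ∃ x ∈ X, ∃ f ∈ range c, ∃ y, φ = Sum.elim x (A (x, f, y))} := by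
    ext φ
    rw [hS]
    constructor
    · rintro ⟨hx, f, hf⟩
      refine ⟨_, hx, _, ⟨f, rfl⟩, φ ∘ Sum.inr ∘ e.symm ∘ Sum.inr, ?_⟩
      ext1 (i | i)
      · rfl
      · simp only [Sum.elim_inr, A, hR', Function.comp_apply, ← hf]
        rw [← e.symm_apply_apply i]
        cases e i <;> simp
    · rintro ⟨x, hx, _, ⟨f, rfl⟩, y, rfl⟩
      refine ⟨hx, f, ?_⟩
      ext1 i
      simp [A, hR']
  refine ⟨_, S, range c, A, h1.comap _, finite_range c, range_nonempty c,
    isAnalyticOnSet_of_analyticAt hAa, hSeq, isAnalyticOnSet_of_analyticAt fun z hz => ?_, ?_,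
    -- The inverse reads the branch off the auxiliary vertices; it is analytic because `idx` is
    -- locally constant near each branch value.
    fun φ => (φ ∘ Sum.inl, c (idx (φ ∘ Sum.inr ∘ e.symm ∘ Sum.inl)),
      φ ∘ Sum.inr ∘ e.symm ∘ Sum.inr), isAnalyticOnSet_of_analyticAt fun φ hφ => ?_, ?_, ?_, ?_⟩
  · exact analyticAt_fst.sumElim (hAa z hz)
  · rintro ⟨x, f, y⟩ ⟨hx, hf, -⟩
    rw [hSeq]
    exact ⟨x, hx, f, hf, y, rfl⟩
  · obtain ⟨hx, f, hf⟩ := (hS φ).1 hφ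
    have q0 : AnalyticAt ℝ (fun φ : Fin a ⊕ Fin (Fintype.card (ν ⊕ Fin k)) → Rn n =>
        φ ∘ Sum.inr ∘ e.symm ∘ Sum.inl) φ := analyticAt_comp_index _ _
    refine (analyticAt_comp_index _ _).prod (AnalyticAt.prod ?_ (analyticAt_comp_index _ _))
    refine AnalyticAt.congr (analyticAt_const (v := c f)) ?_
    have := (h3 _ hx f).2
    rw [← hf] at this
    filter_upwards [q0.continuousAt.eventually this] with ψ hψ
    rw [hψ]
  · intro φ hφ
    exact ⟨((hS φ).1 hφ).1, ⟨_, rfl⟩, trivial⟩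
  · rintro ⟨x, _, y⟩ ⟨hx, ⟨j, rfl⟩, -⟩
    have e1 : A (x, c j, y) ∘ e.symm ∘ Sum.inl = α j x := by
      ext1 i; simp [A, hR']
    have e2 : A (x, c j, y) ∘ e.symm ∘ Sum.inr = y := by
      ext1 i; simp [A]
    have e3 : idx (α j x) = j := (h3 x hx j).2.self_of_nhds
    refine Prod.ext rfl (Prod.ext ?_ e2)
    show c (idx (A (x, c j, y) ∘ e.symm ∘ Sum.inl)) = c j
    rw [e1, e3]
  · intro φ hφ
    obtain ⟨hx, f, hf⟩ := (hS φ).1 hφ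
    have e3 : idx (φ ∘ Sum.inr ∘ e.symm ∘ Sum.inl) = f := by
      rw [hf]; exact (h3 _ hx f).2.self_of_nhds
    ext1 (i | i)
    · rfl
    · simp only [Sum.elim_inr, A, e3, hR', Function.comp_apply, ← hf]
      rw [← e.symm_apply_apply i]
      cases e i <;> simp

end Universality

/-! ### Configuration spaces are compact algebraic sets times translations. -/

section Components

variable {n : ℕ}

/-- Linear maps are entire rational. -/
theorem isEntireRationalMap_linear {E E' : Type*} [NormedAddCommGroup E] [NormedSpace ℝ E]
    [NormedAddCommGroup E'] [NormedSpace ℝ E'] (A : E →ₗ[ℝ] E') :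
    IsEntireRationalMap fun x => A x := fun φ =>
  ⟨_, _, isPolynomialFunction_dual (φ ∘ₗ A), isPolynomialFunction_const 1, fun x =>
    ⟨one_ne_zero, by simp⟩⟩

theorem isRealAlgebraicSet_iInter {E A : Type*} [NormedAddCommGroup E] [NormedSpace ℝ E]
    {X : A → Set E} (h : ∀ a, IsRealAlgebraicSet (X a)) : IsRealAlgebraicSet (⋂ a, X a) := by
  choose S hS hX using h
  refine ⟨⋃ a, S a, fun p hp => ?_, ?_⟩
  · obtain ⟨a, ha⟩ := mem_iUnion.1 hp
    exact hS a p ha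
  · ext x
    simp only [hX, mem_iInter, mem_ofPred_eq, mem_iUnion]
    exact ⟨fun h p ⟨a, ha⟩ => h a p ha, fun h a p ha => h p ⟨a, ha⟩⟩

variable {V : Type*} [Fintype V]

theorem isPolynomialFunction_apply (v : V) (i : Fin n) :
    IsPolynomialFunction fun φ : V → Rn n => φ v i :=
  isPolynomialFunction_dual ((EuclideanSpace.proj (𝕜 := ℝ) i).toLinearMap ∘ₗ
    (LinearMap.proj v : (V → Rn n) →ₗ[ℝ] Rn n))

theorem isRealAlgebraicSet_pin (v : V) (c : Rn n) :
    IsRealAlgebraicSet {φ : V → Rn n | φ v = c} := by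
  refine ⟨range fun (i : Fin n) (φ : V → Rn n) => φ v i - c i, ?_, ?_⟩
  · rintro _ ⟨i, rfl⟩
    exact Subalgebra.sub_mem _ (isPolynomialFunction_apply v i) (isPolynomialFunction_const (c i))
  · ext φ
    simp only [forall_mem_range, mem_ofPred_eq, sub_eq_zero]
    exact ⟨fun h i => by rw [h], fun h => PiLp.ext h⟩

theorem isRealAlgebraicSet_dist (v w : V) {l : ℝ} (hl : 0 ≤ l) :
    IsRealAlgebraicSet {φ : V → Rn n | dist (φ v) (φ w) = l} := by
  refine ⟨{fun φ => ∑ i, (φ v i - φ w i) ^ 2 - l ^ 2}, ?_, ?_⟩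
  · rintro _ rfl
    have hs : (fun φ : V → Rn n => ∑ i, (φ v i - φ w i) ^ 2 - l ^ 2) =
        ∑ i, ((fun φ : V → Rn n => φ v i) - fun φ : V → Rn n => φ w i) ^ 2 - fun _ => l ^ 2 := by
      funext φ
      simp [Finset.sum_apply]
    rw [hs]
    exact Subalgebra.sub_mem _ (Subalgebra.sum_mem _ fun i _ =>
      Subalgebra.pow_mem _ (Subalgebra.sub_mem _ (isPolynomialFunction_apply v i)
        (isPolynomialFunction_apply w i)) 2) (isPolynomialFunction_const _)
  · ext φ
    have h : dist (φ v) (φ w) ^ 2 = ∑ i, (φ v i - φ w i) ^ 2 := by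
      rw [dist_eq_norm, EuclideanSpace.real_norm_sq_eq]
      rfl
    simp only [mem_singleton_iff, forall_eq, mem_ofPred_eq]
    rw [← h, sub_eq_zero, sq_eq_sq₀ dist_nonneg hl]

theorem ClassicalLinkage.isRealAlgebraicSet_configSpace (L : ClassicalLinkage n V) :
    IsRealAlgebraicSet L.configSpace := by
  have h := (isRealAlgebraicSet_iInter fun v : L.fixed =>
    isRealAlgebraicSet_pin (v : V) (L.pos v)).inter
    (isRealAlgebraicSet_iInter fun e : {e : V × V // L.graph.Adj e.1 e.2} =>
      isRealAlgebraicSet_dist (n := n) e.1.1 e.1.2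
        (l := L.len ⟨s(e.1.1, e.1.2), e.2⟩) (L.len ⟨s(e.1.1, e.1.2), e.2⟩).2.le)
  convert h using 1
  ext φ
  simp only [ClassicalLinkage.configSpace, mem_inter_iff, mem_iInter, mem_ofPred_eq, Subtype.forall,
    Prod.forall]

theorem IsPolynomialFunction.continuous {E : Type*} [NormedAddCommGroup E] [NormedSpace ℝ E]
    [FiniteDimensional ℝ E] {p : E → ℝ} (hp : IsPolynomialFunction p) : Continuous p := by
  induction hp using Algebra.adjoin_induction with
  | mem p hp =>
    obtain ⟨φ, rfl⟩ := hp
    exact LinearMap.continuous_of_finiteDimensional φ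
  | algebraMap r => exact continuous_const
  | add p q _ _ hp hq => exact hp.add hq
  | mul p q _ _ hp hq => exact hp.mul hq

theorem IsRealAlgebraicSet.isClosed {E : Type*} [NormedAddCommGroup E] [NormedSpace ℝ E]
    [FiniteDimensional ℝ E] {X : Set E} (hX : IsRealAlgebraicSet X) : IsClosed X := by
  obtain ⟨S, hS, rfl⟩ := hX
  have : {x | ∀ p ∈ S, p x = 0} = ⋂ p ∈ S, {x | p x = 0} := by ext; simp
  rw [this]
  exact isClosed_biInter fun p hp => isClosed_eq (hS p hp).continuous continuous_const

/-- The configuration space is a compact real algebraic set, up to a translation of every component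
without fixed vertices. -/
theorem ClassicalLinkage.exists_areIsomorphic (L : ClassicalLinkage n V) :
    ∃ (d : ℕ) (X : Set (Rn d)), IsRealAlgebraicSet X ∧ IsCompact X ∧
      AreIsomorphic L.configSpace
        (X ×ˢ (univ : Set (Fin L.numFreeComponents → Rn n))) := by
  classical
  let K := {c : L.graph.ConnectedComponent // Disjoint c.supp L.fixed}
  have hK : Finite K := inferInstance
  let e : K ≃ Fin L.numFreeComponents := Finite.equivFin K
  have hb : ∀ c : K, ∃ v, L.graph.connectedComponentMk v = c.1 := fun c => c.1.exists_rep
  choose b hb using hb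
  let comp : V → L.graph.ConnectedComponent := L.graph.connectedComponentMk
  -- A slice for the translations: the chosen vertex of each free component is pinned at the origin.
  let Y : Set (V → Rn n) := L.configSpace ∩ ⋂ c, {φ | φ (b c) = 0}
  have hY : IsRealAlgebraicSet Y :=
    L.isRealAlgebraicSet_configSpace.inter (isRealAlgebraicSet_iInter fun c =>
      isRealAlgebraicSet_pin (b c) 0)
  -- Bounds propagate along walks from a pinned or fixed vertex, each bar adding its length.
  have hbound : ∀ v : V, ∃ M : ℝ, ∀ φ ∈ Y, ‖φ v‖ ≤ M := by
    have hadj : ∀ u v, L.graph.Reachable u v → (∃ M : ℝ, ∀ φ ∈ Y, ‖φ u‖ ≤ M) →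
        ∃ M : ℝ, ∀ φ ∈ Y, ‖φ v‖ ≤ M := by
      rintro u v ⟨w⟩
      induction w with
      | nil => exact id
      | @cons u v _ h _ ih =>
        rintro ⟨M, hM⟩
        refine ih ⟨M + L.len ⟨s(u, v), h⟩, fun φ hφ => ?_⟩
        rw [← hφ.1.2 u v h]
        have h1 := norm_sub_norm_le (φ v) (φ u)
        have h2 := hM φ hφ
        rw [← dist_eq_norm, dist_comm] at h1
        linarith
    intro v
    by_cases h : Disjoint (comp v).supp L.fixed
    · refine hadj (b ⟨comp v, h⟩) v (SimpleGraph.ConnectedComponent.exact (hb ⟨comp v, h⟩))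
        ⟨0, fun φ hφ => ?_⟩
      have : φ (b ⟨comp v, h⟩) = 0 := mem_iInter.1 hφ.2 ⟨comp v, h⟩
      rw [this, norm_zero]
    · obtain ⟨u, hu, hu'⟩ := not_disjoint_iff.1 h
      refine hadj u v (SimpleGraph.ConnectedComponent.exact hu) ⟨‖L.pos ⟨u, hu'⟩‖, fun φ hφ => ?_⟩
      rw [← hφ.1.1 ⟨u, hu'⟩]
  choose M hM using hbound
  have hYc : IsCompact Y :=
    (isCompact_univ_pi fun v => isCompact_closedBall (0 : Rn n) (M v)).of_isClosed_subset
      hY.isClosed fun φ hφ v _ => mem_closedBall_zero_iff.2 (hM v φ hφ)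
  let J : (V → Rn n) ≃L[ℝ] Rn (Module.finrank ℝ (V → Rn n)) :=
    ContinuousLinearEquiv.ofFinrankEq (by rw [finrank_euclideanSpace_fin])
  -- `T y` moves each free component `c` by `y c` and nothing else. It is constant along bars and
  -- inverts evaluation at the chosen vertices.
  let T : (K → Rn n) →ₗ[ℝ] (V → Rn n) :=
    LinearMap.pi fun v => if h : Disjoint (comp v).supp L.fixed then
      LinearMap.proj ⟨comp v, h⟩ else 0
  have hT : ∀ y v (h : Disjoint (comp v).supp L.fixed), T y v = y ⟨comp v, h⟩ := by
    intro y v h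
    simp only [T, LinearMap.pi_apply, dif_pos h]
    rfl
  have hT' : ∀ y v, ¬ Disjoint (comp v).supp L.fixed → T y v = 0 := by
    intro y v h
    simp only [T, LinearMap.pi_apply, dif_neg h]
    rfl
  have hTb : ∀ y c, T y (b c) = y c := by
    intro y c
    have hc : comp (b c) = c.1 := hb c
    rw [hT y (b c) (by rw [hc]; exact c.2)]
    congr 1
    exact Subtype.ext hc
  have hTadj : ∀ y v w, L.graph.Adj v w → T y v = T y w := by
    intro y v w hvw
    have hc : comp v = comp w := SimpleGraph.ConnectedComponent.sound hvw.reachable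
    by_cases h : Disjoint (comp v).supp L.fixed
    · rw [hT y v h, hT y w (hc ▸ h)]
      congr 1
      exact Subtype.ext hc
    · rw [hT' y v h, hT' y w (hc ▸ h)]
  have hTmem : ∀ y φ, φ ∈ L.configSpace → φ + T y ∈ L.configSpace := by
    rintro y φ ⟨h1, h2⟩
    refine ⟨fun v => ?_, fun v w hvw => ?_⟩
    · rw [Pi.add_apply, hT', add_zero, h1]
      exact not_disjoint_iff.2 ⟨v, rfl, v.2⟩
    · rw [Pi.add_apply, Pi.add_apply, hTadj y v w hvw, dist_add_right, h2 v w hvw]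
  let B : (V → Rn n) →ₗ[ℝ] (K → Rn n) := LinearMap.funLeft ℝ (Rn n) b
  let f : (V → Rn n) →ₗ[ℝ]
      Rn (Module.finrank ℝ (V → Rn n)) × (Fin L.numFreeComponents → Rn n) :=
    (J.toLinearMap ∘ₗ (LinearMap.id - T ∘ₗ B)).prod (LinearMap.funLeft ℝ (Rn n) e.symm ∘ₗ B)
  let g : Rn (Module.finrank ℝ (V → Rn n)) × (Fin L.numFreeComponents → Rn n) →ₗ[ℝ]
      (V → Rn n) := J.symm.toLinearMap ∘ₗ LinearMap.fst ℝ _ _ +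
        T ∘ₗ LinearMap.funLeft ℝ (Rn n) e ∘ₗ LinearMap.snd ℝ _ _
  have hf : ∀ φ, f φ = (J (φ - T (φ ∘ b)), (φ ∘ b) ∘ e.symm) := fun φ => rfl
  have hg : ∀ z, g z = J.symm z.1 + T (z.2 ∘ e) := fun z => rfl
  refine ⟨_, J.symm.toLinearMap ⁻¹' Y, hY.preimage_linear _, ?_, fun x => f x, fun x => g x,
    isEntireRationalMap_linear f, isEntireRationalMap_linear g, ?_, ?_, ?_, ?_⟩
  · have : (J.symm.toLinearMap ⁻¹' Y : Set (Rn _)) = J '' Y :=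
      (J.toEquiv.image_eq_preimage_symm Y).symm
    rw [this]
    exact hYc.image J.continuous
  · intro φ hφ
    show f φ ∈ _
    rw [hf]
    refine ⟨?_, trivial⟩
    show J.symm (J (φ - T (φ ∘ b))) ∈ Y
    rw [J.symm_apply_apply]
    refine ⟨?_, mem_iInter.2 fun c => ?_⟩
    · have := hTmem (-(φ ∘ b)) φ hφ
      rwa [map_neg, ← sub_eq_add_neg] at this
    · show (φ - T (φ ∘ b)) (b c) = 0
      rw [Pi.sub_apply, hTb, Function.comp_apply, sub_self]
  · rintro ⟨x, y⟩ ⟨hx, -⟩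
    show g (x, y) ∈ _
    rw [hg]
    exact hTmem _ _ (show J.symm x ∈ Y from hx).1
  · intro φ hφ
    simp only [hf, hg, J.symm_apply_apply]
    rw [Function.comp_assoc _ e.symm e, e.symm_comp_self, Function.comp_id, sub_add_cancel]
  · rintro ⟨x, y⟩ ⟨hx, -⟩
    have hx' : J.symm x ∈ Y := hx
    have h1 : (J.symm x + T (y ∘ e)) ∘ b = y ∘ e := by
      funext c
      have : J.symm x (b c) = 0 := mem_iInter.1 hx'.2 c
      rw [Function.comp_apply, Pi.add_apply, this, hTb, zero_add]
    simp only [hf, hg, h1, add_sub_cancel_right, J.apply_symm_apply]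
    rw [Function.comp_assoc, e.self_comp_symm, Function.comp_id]

end Components

/-! ### Assembly of the theorem. -/

theorem areAnalyticallyIsomorphic_empty {E E' : Type*} [NormedAddCommGroup E] [NormedSpace ℝ E]
    [NormedAddCommGroup E'] [NormedSpace ℝ E'] :
    AreAnalyticallyIsomorphic (∅ : Set E) (∅ : Set E') :=
  areAnalyticallyIsomorphic_of_maps (f := fun _ => 0) (g := fun _ => 0)
    (fun _ => analyticAt_const) (fun _ => analyticAt_const) (mapsTo_empty _ _) (mapsTo_empty _ _)
    ⟨fun _ h => h.elim, fun _ h => h.elim⟩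

theorem exists_linkage_iso {n : ℕ} (hn : 2 ≤ n) {d : ℕ} {X : Set (Rn d)} (k : ℕ)
    (hX : IsRealAlgebraicSet X) (hXc : IsCompact X) :
    ∃ (m : ℕ) (L : ClassicalLinkage n (Fin m)) (F : Set ℝ), F.Finite ∧ F.Nonempty ∧
      AreAnalyticallyIsomorphic L.configSpace
        (X ×ˢ F ×ˢ (univ : Set (Fin k → Rn n))) := by
  rcases X.eq_empty_or_nonempty with rfl | ⟨x₁, hx₁⟩
  · obtain ⟨L, hL⟩ := (isConfig_empty (n := n) (ι := Fin 2)).exists_linkage (Or.inr inferInstance)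
    refine ⟨2, L, {0}, finite_singleton _, singleton_nonempty _, ?_⟩
    rw [hL, empty_prod]
    exact areAnalyticallyIsomorphic_empty
  let i₀ : Fin n := ⟨0, by lia⟩
  -- Each coordinate of `ℝᵈ` becomes a vertex on the first axis of `ℝⁿ`. `B` is a left inverse of
  -- `A`, so the image of `X` is again algebraic.
  let A : Rn d →ₗ[ℝ] (Fin d → Rn n) := LinearMap.pi fun i =>
    ((EuclideanSpace.proj (𝕜 := ℝ) i).toLinearMap).smulRight (unitVec i₀)
  let B : (Fin d → Rn n) →ₗ[ℝ] Rn d := (WithLp.linearEquiv 2 ℝ (Fin d → ℝ)).symm.toLinearMap ∘ₗ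
    LinearMap.pi fun i => (EuclideanSpace.proj (𝕜 := ℝ) i₀).toLinearMap ∘ₗ LinearMap.proj i
  have hBA : ∀ x, B (A x) = x := by
    intro x
    ext i
    simp [A, B]
  have hX' : IsRealAlgebraicSet (B ⁻¹' X ∩ {y | (A ∘ₗ B) y = (LinearMap.id : (Fin d → Rn n) →ₗ[ℝ] _) y}) :=
    (hX.preimage_linear B).inter (isRealAlgebraicSet_linear_eq _ _)
  have himage : B ⁻¹' X ∩ {y | (A ∘ₗ B) y = (LinearMap.id : (Fin d → Rn n) →ₗ[ℝ] _) y} = A '' X := by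
    ext y
    constructor
    · rintro ⟨h1, h2⟩
      exact ⟨B y, h1, h2⟩
    · rintro ⟨x, hx, rfl⟩
      refine ⟨?_, ?_⟩
      · show B (A x) ∈ X
        rwa [hBA]
      · show A (B (A x)) = A x
        rw [hBA]
  rw [himage] at hX'
  have hAc : ∀ x, AnalyticAt ℝ A x := fun x => (LinearMap.toContinuousLinearMap A).analyticAt x
  have hBc : ∀ x, AnalyticAt ℝ B x := fun x => (LinearMap.toContinuousLinearMap B).analyticAt x
  obtain ⟨m, S, F, α, h1, h2, h3, -, h4, h5⟩ := exists_config_iso hn k hX'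
    (hXc.image (LinearMap.continuous_of_finiteDimensional A))
  let e : Fin d ⊕ Fin m ≃ Fin (d + m) := finSumFinEquiv
  obtain ⟨f₁, hf₁⟩ := h3
  have hne : ({φ : Fin (d + m) → Rn n | φ ∘ e ∈ S}).Nonempty := by
    refine ⟨Sum.elim (A x₁) (α (A x₁, f₁, 0)) ∘ e.symm, ?_⟩
    show (_ ∘ e.symm) ∘ e ∈ S
    rw [Function.comp_assoc, e.symm_comp_self, Function.comp_id, h4]
    exact ⟨_, mem_image_of_mem _ hx₁, f₁, hf₁, 0, rfl⟩
  obtain ⟨L, hL⟩ := (h1.comap e).exists_linkage (Or.inl hne)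
  refine ⟨d + m, L, F, h2, ⟨f₁, hf₁⟩, ?_⟩
  rw [hL]
  have i1 : AreAnalyticallyIsomorphic {φ : Fin (d + m) → Rn n | φ ∘ e ∈ S} S := by
    refine areAnalyticallyIsomorphic_of_maps (f := fun φ => φ ∘ e) (g := fun φ => φ ∘ e.symm)
      (analyticAt_comp_index _) (analyticAt_comp_index _) (fun φ hφ => hφ) (fun φ hφ => ?_)
      ⟨fun φ _ => ?_, fun φ _ => ?_⟩
    · show (φ ∘ e.symm) ∘ e ∈ S
      rwa [Function.comp_assoc, e.symm_comp_self, Function.comp_id]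
    · show (φ ∘ e) ∘ e.symm = φ
      rw [Function.comp_assoc, e.self_comp_symm, Function.comp_id]
    · show (φ ∘ e.symm) ∘ e = φ
      rw [Function.comp_assoc, e.symm_comp_self, Function.comp_id]
  have i2 : AreAnalyticallyIsomorphic S ((A '' X) ×ˢ F ×ˢ (univ : Set (Fin k → Rn n))) :=
    AreAnalyticallyIsomorphic.symm ⟨_, h5⟩
  refine (i1.trans i2).trans (areAnalyticallyIsomorphic_of_maps (f := fun z => (B z.1, z.2))
    (g := fun z => (A z.1, z.2)) (fun z => ?_) (fun z => ?_) ?_ ?_ ⟨?_, ?_⟩)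
  · have q := (hBc z.1).comp_of_eq (analyticAt_fst (p := z)) rfl
    exact q.prod analyticAt_snd
  · have q := (hAc z.1).comp_of_eq (analyticAt_fst (p := z)) rfl
    exact q.prod analyticAt_snd
  · rintro ⟨_, z⟩ ⟨⟨x, hx, rfl⟩, hz⟩
    exact ⟨by show B (A x) ∈ X; rwa [hBA], hz⟩
  · rintro ⟨x, z⟩ ⟨hx, hz⟩
    exact ⟨mem_image_of_mem _ hx, hz⟩
  · rintro ⟨_, z⟩ ⟨⟨x, hx, rfl⟩, hz⟩
    simp only [hBA]
  · rintro ⟨x, z⟩ _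
    simp only [hBA]

theorem exists_linkage_graph {n : ℕ} (hn : 2 ≤ n) {a : ℕ} {X : Set (Fin a → Rn n)} (k : ℕ)
    (hX : IsRealAlgebraicSet X) (hXc : IsCompact X) :
    ∃ (m : ℕ) (L : ClassicalLinkage n (Fin a ⊕ Fin m)) (F : Set ℝ)
      (α : (Fin a → Rn n) × ℝ × (Fin k → Rn n) → (Fin m → Rn n)),
      F.Finite ∧ F.Nonempty ∧
      IsAnalyticOnSet α (X ×ˢ F ×ˢ univ) ∧
      L.configSpace = {φ | ∃ x ∈ X, ∃ f ∈ F, ∃ y, φ = Sum.elim x (α (x, f, y))} ∧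
      IsAnalyticIso (fun z : (Fin a → Rn n) × ℝ × (Fin k → Rn n) => Sum.elim z.1 (α z))
        (X ×ˢ F ×ˢ univ) L.configSpace := by
  rcases X.eq_empty_or_nonempty with rfl | ⟨x₁, hx₁⟩
  · have : Nontrivial (Fin a ⊕ Fin 2) := ⟨.inr 0, .inr 1, by simp⟩
    obtain ⟨L, hL⟩ := (isConfig_empty (n := n) (ι := Fin a ⊕ Fin 2)).exists_linkage
      (Or.inr inferInstance)
    refine ⟨2, L, {0}, fun _ => 0, finite_singleton _, singleton_nonempty _, ?_, ?_, ?_⟩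
    · rw [empty_prod]
      exact isAnalyticOnSet_of_analyticAt fun _ h => h.elim
    · rw [hL]
      simp
    · rw [hL, empty_prod]
      exact ⟨isAnalyticOnSet_of_analyticAt fun _ h => h.elim, mapsTo_empty _ _, fun _ => 0,
        isAnalyticOnSet_of_analyticAt fun _ h => h.elim, mapsTo_empty _ _,
        fun _ h => h.elim, fun _ h => h.elim⟩
  · obtain ⟨m, S, F, α, h1, h2, h3, h4, h5, h6⟩ := exists_config_iso hn k hX hXc
    obtain ⟨f₁, hf₁⟩ := h3
    have hne : S.Nonempty := by
      rw [h5]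
      exact ⟨_, x₁, hx₁, f₁, hf₁, 0, rfl⟩
    obtain ⟨L, rfl⟩ := h1.exists_linkage (Or.inl hne)
    exact ⟨m, L, F, α, h2, ⟨f₁, hf₁⟩, h4, h5, h6⟩

theorem mainTheorem1 (n : ℕ) (hn : 2 ≤ n) :
    -- every configuration space is isomorphic to (compact real algebraic set) × (ℝⁿ)ᵏ
    (∀ (V : Type*) [Fintype V] (L : ClassicalLinkage n V),
      ∃ (d : ℕ) (X : Set (Rn d)), IsRealAlgebraicSet X ∧ IsCompact X ∧
        AreIsomorphic L.configSpace
          (X ×ˢ (univ : Set (Fin L.numFreeComponents → Rn n)))) ∧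
    -- conversely, for every compact real algebraic set X ⊆ ℝᵈ and every k
    (∀ (d : ℕ) (X : Set (Rn d)) (k : ℕ), IsRealAlgebraicSet X → IsCompact X →
      ∃ (m : ℕ) (L : ClassicalLinkage n (Fin m)) (F : Set ℝ), F.Finite ∧ F.Nonempty ∧
        AreAnalyticallyIsomorphic L.configSpace
          (X ×ˢ F ×ˢ (univ : Set (Fin k → Rn n)))) ∧
    -- and, for X ⊆ (ℝⁿ)ᵃ, the isomorphism can be taken to be (x, f, y) ↦ (x, α (x, f, y))
    (∀ (a : ℕ) (X : Set (Fin a → Rn n)) (k : ℕ), IsRealAlgebraicSet X → IsCompact X →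
      ∃ (m : ℕ) (L : ClassicalLinkage n (Fin a ⊕ Fin m)) (F : Set ℝ)
        (α : (Fin a → Rn n) × ℝ × (Fin k → Rn n) → (Fin m → Rn n)),
        F.Finite ∧ F.Nonempty ∧
        IsAnalyticOnSet α (X ×ˢ F ×ˢ univ) ∧
        L.configSpace = {φ | ∃ x ∈ X, ∃ f ∈ F, ∃ y, φ = Sum.elim x (α (x, f, y))} ∧
        IsAnalyticIso (fun z : (Fin a → Rn n) × ℝ × (Fin k → Rn n) => Sum.elim z.1 (α z))
          (X ×ˢ F ×ˢ univ) L.configSpace) := by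

  exact ⟨fun V _ L => L.exists_areIsomorphic, fun d X k hX hXc => exists_linkage_iso hn k hX hXc,
    fun a X k hX hXc => exists_linkage_graph hn k hX hXc⟩
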